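/- **Setting.** A *Beurling generalized prime system* is an unbounded sequence of real numbers $1<p_1\le p_2\le\dots$. Its generalized integers $1=n_0<n_1\le n_2\le\dots$ are all products $\prod_k p_k^{\alpha_k}$ (with $\alpha_k\in\mathbb{N}$, almost all zero), counted with multiplicity; $N(x)=\sum_{n_k\le x}1$, $\zeta(s)=\sum_k n_k^{-s}$, and $\mu\left(\prod_k p_k^{\alpha_k}\right)=(-1)^{\sum_k\alpha_k}$ if all $\alpha_k\le 1$ and $0$ otherwise. Put $m(x)=\sum_{n_k\le x}\mu(n_k)/n_k$. More generally, a (not necessarily discrete) *generalized number system* consists of right-continuous non-decreasing functions $N$ and $\Pi$, with $N(x)=0$ for $x<1$ and $\Pi(x)=0$ for $x\le 1$, such that $$\zeta(s)=\int_{1^-}^\infty x^{-s}\,\mathrm{d}N(x)=\exp\left(\int_1^\infty x^{-s}\,\mathrm{d}\Pi(x)\right)$$ with both integrals absolutely convergent on some right half-plane. In this case $\mathrm{d}M$ denotes the inverse of $\mathrm{d}N$ with respect to multiplicative convolution of (signed, locally finite) measures on $[1,\infty)$, and $m(x)=\int_{1^-}^x \mathrm{d}M(t)/t$. **Theorem.**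 Consider either a Beurling generalized prime system or a generalized number system. Suppose that $N(x)\sim ax$ as $x\to\infty$ for some $a>0$, and that there are a (finite or infinite, possibly empty) set of points $0<t_1<t_2<\dots$ having only finitely many elements in each bounded interval, and constants $\beta_n<1$, such that for each $T>0$ there is $K_T>0$ with $$\log|\zeta(\sigma+it)|>-K_T-\log|\sigma-1+it|+\sum_{0<t_n<T}\beta_n\log|\sigma-1+i(t-t_n)|$$ for all $0<t<T$ and $1<\sigma<2$. Then $m(x)\to 0$ as $x\to\infty$. (In the non-discrete case, the convolution inverse $\mathrm{d}M$ exists.) -/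

import Mathlib

open MeasureTheory Filter Topology

noncomputable section

namespace Beurling

/-- The lower bound for a zeta function `Z` near the line `Re s = 1`: there are a set `S` of
positive ordinates with only finitely many elements below any given height, and exponents
`β τ < 1` for `τ ∈ S`, such that for every `T > 0` there is `K > 0` with
`log |Z (σ + i t)| > - K - log |σ - 1 + i t| + ∑_{τ ∈ S, τ < T} β τ * log |σ - 1 + i (t - τ)|`
for `0 < t < T` and `1 < σ < 2`. -/
def ZetaLowerBound (Z : ℂ → ℂ) : Prop :=
  ∃ (S : Set ℝ) (β : ℝ → ℝ) (hS : ∀ T : ℝ, (S ∩ Set.Iio T).Finite),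
    (∀ τ ∈ S, 0 < τ) ∧ (∀ τ ∈ S, β τ < 1) ∧
    ∀ T : ℝ, 0 < T → ∃ K : ℝ, 0 < K ∧
      ∀ t : ℝ, 0 < t → t < T → ∀ σ : ℝ, 1 < σ → σ < 2 →
        Real.log ‖Z ((σ : ℂ) + Complex.I * (t : ℂ))‖ >
          -K - Real.log ‖(σ : ℂ) - 1 + Complex.I * (t : ℂ)‖
            + ∑ τ ∈ (hS T).toFinset,
                β τ * Real.log ‖(σ : ℂ) - 1 + Complex.I * ((t : ℂ) - (τ : ℂ))‖

/-! ### Generalized number systems given by non-decreasing functions -/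

/-- `∫_{1^-}^∞ x^{-s} dF(x)`, for a right-continuous non-decreasing `F` vanishing on `(-∞, 1)`. -/
def mellinStieltjes (F : StieltjesFunction ℝ) (s : ℂ) : ℂ :=
  ∫ x : ℝ, (x : ℂ) ^ (-s) ∂F.measure

/-- A (not necessarily discrete) generalized number system: non-decreasing right-continuous
functions `N` and `Pi`, carried by `[1, ∞)` and `(1, ∞)` respectively, which are linked by
`∫_{1^-}^∞ x^{-s} dN(x) = exp (∫_1^∞ x^{-s} dPi(x))`, both integrals being absolutely convergent
on some right half-plane. -/
structure System where
  /-- the counting function of the generalized integers -/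
  N : StieltjesFunction ℝ
  /-- the (Riemann) counting function of the generalized primes -/
  Pi : StieltjesFunction ℝ
  N_eq_zero : ∀ x < 1, N x = 0
  Pi_eq_zero : ∀ x ≤ 1, Pi x = 0
  link : ∃ σ₀ : ℝ, ∀ s : ℂ, σ₀ < s.re →
    Integrable (fun x : ℝ => (x : ℂ) ^ (-s)) N.measure ∧
    Integrable (fun x : ℝ => (x : ℂ) ^ (-s)) Pi.measure ∧
    mellinStieltjes N s = Complex.exp (mellinStieltjes Pi s)

/-- The zeta function `ζ(s) = ∫_{1^-}^∞ x^{-s} dN(x)` of a generalized number system. -/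
def System.zeta (B : System) (s : ℂ) : ℂ := mellinStieltjes B.N s

/-- The signed measure `dM = dP - dQ` on `[1, ∞)` (`P`, `Q` non-decreasing and right-continuous)
is the inverse of `dN` for multiplicative convolution: `dN * dM = δ₁`. Moving the subtracted part
to the other side, this is an identity between positive measures, finite on bounded sets. -/
def IsConvInverse (N P Q : StieltjesFunction ℝ) : Prop :=
  (∀ x < 1, P x = 0) ∧ (∀ x < 1, Q x = 0) ∧
    Measure.mconv N.measure P.measure = Measure.dirac 1 + Measure.mconv N.measure Q.measure

/-- `m(x) = ∫_{1^-}^x dM(t) / t` where `dM = dP - dQ`. -/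
def moebiusMean (P Q : StieltjesFunction ℝ) (x : ℝ) : ℝ :=
  (∫ t in Set.Icc 1 x, t⁻¹ ∂P.measure) - ∫ t in Set.Icc 1 x, t⁻¹ ∂Q.measure

/-! ### Discrete generalized number systems -/

/-- A Beurling generalized prime system: an unbounded non-decreasing sequence of reals `> 1`. -/
structure Primes where
  /-- the generalized primes, repeated according to multiplicity -/
  p : ℕ → ℝ
  mono : Monotone p
  one_lt : 1 < p 0
  unbounded : ¬ BddAbove (Set.range p)

namespace Primes

variable (P : Primes)

/-- The value `∏ p_k ^ {α_k}` of the generalized integer with exponent vector `α`. The family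
`(P.int α)_α` lists the generalized integers with their multiplicities. -/
def int (α : ℕ →₀ ℕ) : ℝ := α.prod fun k e => P.p k ^ e

/-- The Beurling Möbius function: `(-1)^r` on a product of `r` generalized primes with different
indices, and `0` if some prime of the sequence is repeated. -/
def moebius (α : ℕ →₀ ℕ) : ℝ :=
  open Classical in if ∀ k, α k ≤ 1 then (-1) ^ (α.sum fun _ e => e) else 0

theorem one_lt_p (k : ℕ) : 1 < P.p k := P.one_lt.trans_le (P.mono (Nat.zero_le k))

theorem pow_le_int (α : ℕ →₀ ℕ) (k : ℕ) : P.p k ^ α k ≤ P.int α := by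
  have h1 : ∀ j, 1 ≤ P.p j ^ α j := fun j => one_le_pow₀ (P.one_lt_p j).le
  unfold int Finsupp.prod
  by_cases hk : k ∈ α.support
  · rw [← Finset.mul_prod_erase _ _ hk]
    refine le_mul_of_one_le_right (zero_le_one.trans (h1 k)) ?_
    exact Finset.prod_induction _ (fun y => 1 ≤ y) (fun a b => one_le_mul_of_one_le_of_one_le)
      le_rfl (fun j _ => h1 j)
  · rw [Finsupp.notMem_support_iff.mp hk, pow_zero]
    exact Finset.prod_induction _ (fun y => 1 ≤ y) (fun a b => one_le_mul_of_one_le_of_one_le)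
      le_rfl (fun j _ => h1 j)

/-- Only finitely many generalized integers are `≤ x`. -/
theorem finite_int_le (x : ℝ) : {α : ℕ →₀ ℕ | P.int α ≤ x}.Finite := by
  obtain ⟨K, hK⟩ : ∃ K, x < P.p K := by
    by_contra! h
    exact P.unbounded ⟨x, by rintro _ ⟨k, rfl⟩; exact h k⟩
  obtain ⟨L, hL⟩ := pow_unbounded_of_one_lt x P.one_lt
  refine (Set.finite_Iic (Finsupp.indicator (Finset.range K) fun _ _ => L)).subset ?_
  intro α (hα : P.int α ≤ x) k
  rw [Finsupp.indicator_apply]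
  have hp := (P.pow_le_int α k).trans hα
  split_ifs with hk
  · by_contra! hlt
    have h1 : P.p 0 ^ L ≤ P.p k ^ α k :=
      (pow_le_pow_right₀ P.one_lt.le hlt.le).trans
        (pow_le_pow_left₀ (zero_le_one.trans P.one_lt.le) (P.mono (Nat.zero_le k)) _)
    linarith
  · by_contra! hlt
    have h1 : P.p K ≤ P.p k := P.mono (by simpa using hk)
    have h2 : P.p k ≤ P.p k ^ α k := le_self_pow₀ (P.one_lt_p k).le (by omega)
    linarith

/-- The counting function `N(x)` of the generalized integers. -/
def count (x : ℝ) : ℕ := (P.finite_int_le x).toFinset.card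

/-- The zeta function `ζ(s) = ∑ n_k^{-s}`. -/
def zeta (s : ℂ) : ℂ := ∑' α : ℕ →₀ ℕ, ((P.int α : ℝ) : ℂ) ^ (-s)

/-- `m(x) = ∑_{n_k ≤ x} μ(n_k) / n_k`. -/
def moebiusSum (x : ℝ) : ℝ := ∑ α ∈ (P.finite_int_le x).toFinset, moebius α / P.int α

end Primes

end Beurling

end

/-! Put τ(u) = m(e^u). Partial summation gives the Laplace transform of τ as G(s) = 1/(s ζ(1+s)) for
Re s > 0. The lower bound for log|ζ| says that |G(σ+it)| is at most a constant times a finite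
product of powers |t - t_n|^(-max(β_n, 0)), uniformly in 0 < σ < 1 for bounded t. Since each β_n < 1
and the t_n are distinct, this product is integrable (`exists_integrable_majorant`). No boundary
values of G are assumed or constructed; the majorant alone is used.

A Tauberian theorem finishes the argument (`tendsto_zero_of_slowlyOscillating`). Convolve τ with a
kernel whose Fourier transform has compact support. The result is a pointwise limit, as σ → 0, of
Fourier integrals of functions dominated by one integrable function. By weak compactness in L² such
a limit is itself the Fourier integral of an integrable function, so it vanishes at infinity by
Riemann–Lebesgue (`tendsto_zero_of_dominated_fourier`). The smoothing is removed by slow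
oscillation: |τ(v) - τ(u)| ≤ e^(-u) (N(e^v) - N(e^u)), and N(x) ~ ax makes this small for large u
and v close to u. The function τ is not known to be bounded beforehand, only to grow at most
linearly.

All of this runs for measures P, Q ≤ dN with dM = P - Q (`tendsto_mean_of_mellin`). In the discrete
case P and Q collect the integers with μ = 1 and μ = -1. In general dN = exp(dΠ) for convolution,
and P = cosh(dΠ), Q = sinh(dΠ) satisfy P + Q = dN and dN * (P - Q) = δ₁ (`exists_split`). Any other
inverse yields the same m (`moebiusMean_eq_of_isConvInverse`). -/

noncomputable section

namespace Beurling

open scoped FourierTransform ComplexConjugate SchwartzMap ContDiff ENNReal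

/-! ### Fourier integrals with a common majorant -/

/-- If functions `h n` with a common integrable majorant have pointwise convergent Fourier
integrals, then the limit vanishes at infinity. -/
theorem tendsto_zero_of_dominated_fourier {g : ℝ → ℝ} (hg : Integrable g) {h : ℕ → ℝ → ℂ}
    (hm : ∀ n, AEStronglyMeasurable (h n)) (hb : ∀ n, ∀ᵐ t, ‖h n t‖ ≤ g t) {I : ℝ → ℂ}
    (hI : ∀ y, Tendsto (fun n => ∫ t, (Real.fourierChar (-(t * y)) : ℂ) * h n t) atTop
      (𝓝 (I y))) :
    Tendsto I atTop (𝓝 0) := by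
  have hg0 : ∀ᵐ t, 0 ≤ g t := (hb 0).mono fun t ht => (norm_nonneg _).trans ht
  have hsm : AEStronglyMeasurable (fun t => ((√(g t) : ℝ) : ℂ)) :=
    Complex.continuous_ofReal.comp_aestronglyMeasurable
      (Real.continuous_sqrt.comp_aestronglyMeasurable hg.aestronglyMeasurable)
  have hs2 : MemLp (fun t => ((√(g t) : ℝ) : ℂ)) 2 := by
    rw [memLp_two_iff_integrable_sq_norm hsm]
    refine hg.congr (hg0.mono fun t ht => ?_)
    simp [Real.sq_sqrt ht]
  have hvm : ∀ n, AEStronglyMeasurable (fun t => conj (h n t) / ((√(g t) : ℝ) : ℂ)) := fun n =>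
    ((Complex.continuous_conj.comp_aestronglyMeasurable (hm n)).aemeasurable.div
      hsm.aemeasurable).aestronglyMeasurable
  have hvb : ∀ n, ∀ᵐ t, ‖conj (h n t) / ((√(g t) : ℝ) : ℂ)‖ ≤ ‖((√(g t) : ℝ) : ℂ)‖ := by
    intro n
    filter_upwards [hb n] with t ht
    rw [norm_div, RCLike.norm_conj]
    rcases eq_or_ne ‖((√(g t) : ℝ) : ℂ)‖ 0 with h0 | h0
    · rw [h0]; simp
    · have h1 : 0 < ‖((√(g t) : ℝ) : ℂ)‖ := lt_of_le_of_ne (norm_nonneg _) (Ne.symm h0)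
      rw [div_le_iff₀ h1]
      have : 0 ≤ g t := (norm_nonneg _).trans ht
      simpa [Real.mul_self_sqrt this, abs_of_nonneg (Real.sqrt_nonneg _)] using ht
  have hv2 : ∀ n, MemLp (fun t => conj (h n t) / ((√(g t) : ℝ) : ℂ)) 2 := fun n =>
    hs2.mono (hvm n) (hvb n)
  have hem : ∀ y, AEStronglyMeasurable
      (fun t => (Real.fourierChar (-(t * y)) : ℂ) * ((√(g t) : ℝ) : ℂ)) := by
    intro y
    refine AEStronglyMeasurable.mul ?_ hsm
    apply Continuous.aestronglyMeasurable
    exact continuous_subtype_val.comp (Real.continuous_fourierChar.comp (by fun_prop))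
  have he2 : ∀ y, MemLp (fun t => (Real.fourierChar (-(t * y)) : ℂ) * ((√(g t) : ℝ) : ℂ)) 2 :=
    fun y => hs2.mono (hem y) (Eventually.of_forall fun t => by
      rw [norm_mul, Circle.norm_coe, one_mul])
  -- Splitting h n = √g · (h n / √g) turns an L¹ domination into an L² bound, where balls are weakly
  -- compact. The conjugate undoes the conjugate-linearity of the inner product in its first slot.
  -- Where g = 0 the quotient is 0 by convention, and h n vanishes there too.
  let v : ℕ → Lp ℂ 2 (volume : Measure ℝ) := fun n => (hv2 n).toLp _
  let e : ℝ → Lp ℂ 2 (volume : Measure ℝ) := fun y => (he2 y).toLp _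
  have hinner : ∀ n y, inner ℂ (v n) (e y) =
      ∫ t, (Real.fourierChar (-(t * y)) : ℂ) * h n t := by
    intro n y
    rw [L2.inner_def]
    apply integral_congr_ae
    filter_upwards [(hv2 n).coeFn_toLp, (he2 y).coeFn_toLp, hb n] with t h1 h2 h3
    simp only [v, e, h1, h2, RCLike.inner_apply, map_div₀, RCLike.conj_conj, Complex.conj_ofReal]
    rcases eq_or_ne ((√(g t) : ℝ) : ℂ) 0 with h0 | h0
    · have : g t ≤ 0 := Real.sqrt_eq_zero'.mp (by exact_mod_cast h0)
      have : h n t = 0 := norm_le_zero_iff.mp (h3.trans this)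
      simp [this]
    · field_simp
  have hvn : ∀ n, ‖v n‖ ≤ ‖hs2.toLp‖ := by
    intro n
    apply Lp.norm_le_norm_of_ae_le
    filter_upwards [(hv2 n).coeFn_toLp, hs2.coeFn_toLp, hvb n] with t h1 h2 h3
    rw [h1, h2]; exact h3
  -- Banach–Alaoglu along an ultrafilter: a weak limit exists without extracting a subsequence, and
  -- I(y) is still the limit along U.
  let U : Ultrafilter ℕ := Ultrafilter.of atTop
  have hU : (U : Filter ℕ) ≤ atTop := Ultrafilter.of_le _
  let F : ℕ → WeakDual ℂ (Lp ℂ 2 (volume : Measure ℝ)) := fun n =>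
    StrongDual.toWeakDual (InnerProductSpace.toDual ℂ _ (v n))
  have hF : ∀ᶠ n in (U : Filter ℕ), F n ∈ WeakDual.toStrongDual ⁻¹'
      Metric.closedBall (0 : StrongDual ℂ (Lp ℂ 2 (volume : Measure ℝ))) ‖hs2.toLp‖ := by
    refine Eventually.of_forall fun n => ?_
    simpa [F] using hvn n
  obtain ⟨ℓ, -, hℓ⟩ := (WeakDual.isCompact_closedBall _ _).ultrafilter_le_nhds (U.map F)
    (le_principal_iff.mpr hF)
  let w := (InnerProductSpace.toDual ℂ _).symm (WeakDual.toStrongDual ℓ)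
  have hw : ∀ y, inner ℂ w (e y) = I y := by
    intro y
    have h1 : Tendsto (fun n => F n (e y)) U (𝓝 (ℓ (e y))) :=
      ((WeakDual.eval_continuous (e y)).tendsto ℓ).comp hℓ
    have h2 : Tendsto (fun n => F n (e y)) U (𝓝 (I y)) := by
      refine Tendsto.congr (fun n => ?_) ((hI y).mono_left hU)
      rw [← hinner]
      simp [F]
    rw [← tendsto_nhds_unique h1 h2]
    exact InnerProductSpace.toDual_symm_apply
  -- I is now the Fourier integral of √g · conj w, a product of two L² functions, so
  -- Riemann–Lebesgue applies.
  have hR := Real.tendsto_integral_exp_smul_cocompact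
    (fun t => ((√(g t) : ℝ) : ℂ) * conj (w t))
  refine (hR.mono_left atTop_le_cocompact).congr fun y => ?_
  rw [← hw, L2.inner_def]
  apply integral_congr_ae
  filter_upwards [(he2 y).coeFn_toLp] with t h2
  simp only [e, h2, RCLike.inner_apply, Circle.smul_def, smul_eq_mul]
  ring

/-! ### A Tauberian theorem with a local majorant -/

/-- An approximate identity `k` whose Fourier transform `φ` has compact support. -/
structure IsBandLimitedKernel (φ k : ℝ → ℂ) : Prop where
  continuous_dual : Continuous φ
  norm_dual_le : ∀ ξ, ‖φ ξ‖ ≤ 1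
  dual_eq_zero : ∀ ξ, 1 ≤ |ξ| → φ ξ = 0
  integrable_dual : Integrable φ
  eq_integral : ∀ y, k y = ∫ ξ, (Real.fourierChar (-(ξ * y)) : ℂ) * φ ξ
  continuous : Continuous k
  integrable_moment : Integrable fun y => (1 + |y|) * ‖k y‖
  integral_eq_one : ∫ y, k y = 1

/-- Take φ a smooth bump with φ(0) = 1 and k its Fourier transform. Then k is a Schwartz function,
and its integral is φ(0) by Fourier inversion. -/
theorem exists_isBandLimitedKernel : ∃ φ k, IsBandLimitedKernel φ k := by
  let b : ContDiffBump (0 : ℝ) := ⟨1 / 2, 1, by norm_num, by norm_num⟩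
  have hcs : HasCompactSupport (fun x => ((b x : ℝ) : ℂ)) :=
    b.hasCompactSupport.comp_left Complex.ofReal_zero
  have hcd : ContDiff ℝ ∞ (fun x => ((b x : ℝ) : ℂ)) :=
    Complex.ofRealCLM.contDiff.comp b.contDiff
  let φ : 𝓢(ℝ, ℂ) := hcs.toSchwartzMap hcd
  let k : 𝓢(ℝ, ℂ) := 𝓕 φ
  have hφ : ∀ x, φ x = ((b x : ℝ) : ℂ) := fun x => rfl
  refine ⟨φ, k, φ.continuous, fun ξ => ?_, fun ξ hξ => ?_, φ.integrable, fun y => ?_,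
    k.continuous, ?_, ?_⟩
  · rw [hφ, Complex.norm_real, Real.norm_of_nonneg b.nonneg]
    exact b.le_one
  · rw [hφ, b.zero_of_le_dist (by simpa [Real.dist_eq] using hξ), Complex.ofReal_zero]
  · change (𝓕 φ) y = _
    rw [SchwartzMap.fourier_coe, Real.fourier_real_eq]
    rfl
  · have h0 := k.integrable_pow_mul volume 0
    have h1 := k.integrable_pow_mul volume 1
    refine (h0.add h1).congr (Eventually.of_forall fun y => ?_)
    simp only [Pi.add_apply, Real.norm_eq_abs]
    ring
  · have h1 : 𝓕⁻ (𝓕 (φ : ℝ → ℂ)) = φ :=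
      φ.continuous.fourierInv_fourier_eq φ.integrable (by
        rw [← SchwartzMap.fourier_coe]; exact k.integrable)
    have h2 := congrFun h1 0
    rw [Real.fourierInv_eq] at h2
    have h3 : φ 0 = 1 := by
      rw [hφ, b.one_of_mem_closedBall (by simp [b]), Complex.ofReal_one]
    rw [← h3, ← h2]
    simp [k, SchwartzMap.fourier_coe]

/-- The (bilateral) Laplace transform of a real function. -/
def laplace (τ : ℝ → ℝ) (s : ℂ) : ℂ := ∫ u, (τ u : ℂ) * Complex.exp (-s * u)

theorem abs_le_of_abs_sub_le {τ : ℝ → ℝ} (hτ0 : ∀ u < 0, τ u = 0) {C : ℝ}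
    (hC : ∀ u v, |τ v - τ u| ≤ C * (1 + |v - u|)) (u : ℝ) : |τ u| ≤ 2 * C * (1 + |u|) := by
  have h0 : 0 ≤ C := by simpa using hC 0 0
  have h := hC (-1) u
  rw [hτ0 (-1) (by norm_num), sub_zero] at h
  have h2 : |u - -1| ≤ |u| + 1 := by
    simpa using abs_sub u (-1)
  nlinarith [abs_nonneg u]

theorem integrable_mul_exp_of_abs_sub_le {τ : ℝ → ℝ} (hτm : Measurable τ)
    (hτ0 : ∀ u < 0, τ u = 0) {C : ℝ} (hC : ∀ u v, |τ v - τ u| ≤ C * (1 + |v - u|))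
    {σ : ℝ} (hσ : 0 < σ) : Integrable fun u => τ u * Real.exp (-σ * u) := by
  have h0 : 0 ≤ C := by simpa using hC 0 0
  have hg : Integrable ((Set.Ici (0 : ℝ)).indicator fun u =>
      2 * C * (1 + 2 / σ) * Real.exp (-(σ / 2) * u)) := by
    rw [integrable_indicator_iff measurableSet_Ici, integrableOn_Ici_iff_integrableOn_Ioi]
    exact (exp_neg_integrableOn_Ioi 0 (by positivity)).const_mul _
  refine hg.mono (by fun_prop) (Eventually.of_forall fun u => ?_)
  rcases lt_or_ge u 0 with hu | hu
  · simp [hτ0 u hu]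
  · rw [Set.indicator_of_mem (Set.mem_Ici.mpr hu)]
    have h1 := abs_le_of_abs_sub_le hτ0 hC u
    rw [abs_of_nonneg hu] at h1
    have h2 : σ / 2 * u ≤ Real.exp (σ / 2 * u) := by
      linarith [Real.add_one_le_exp (σ / 2 * u)]
    have h3 : u ≤ 2 / σ * Real.exp (σ / 2 * u) := by
      rw [div_mul_eq_mul_div, le_div_iff₀ hσ]; linarith
    have h4 : 1 ≤ Real.exp (σ / 2 * u) := Real.one_le_exp (by positivity)
    have h5 : Real.exp (-σ * u) * Real.exp (σ / 2 * u) = Real.exp (-(σ / 2) * u) := by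
      rw [← Real.exp_add]; congr 1; ring
    rw [norm_mul, Real.norm_eq_abs, Real.norm_of_nonneg (Real.exp_pos _).le,
      Real.norm_of_nonneg (by positivity), ← h5]
    have h6 : 1 + u ≤ (1 + 2 / σ) * Real.exp (σ / 2 * u) := by nlinarith
    calc |τ u| * Real.exp (-σ * u) ≤ (2 * C * (1 + u)) * Real.exp (-σ * u) := by gcongr
      _ ≤ (2 * C * ((1 + 2 / σ) * Real.exp (σ / 2 * u))) * Real.exp (-σ * u) := by gcongr
      _ = _ := by ring

/-- The smoothed function is the Fourier integral of a cut-off of the Laplace transform. -/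
theorem integral_mul_kernel_eq {τ : ℝ → ℝ} (hτm : Measurable τ)
    {σ : ℝ} (hi : Integrable fun u => τ u * Real.exp (-σ * u)) {φ k : ℝ → ℂ}
    (hk : IsBandLimitedKernel φ k) (l x : ℝ) :
    ∫ u, ((τ u * Real.exp (-σ * u) : ℝ) : ℂ) * (l * k (l * (x - u))) =
      ∫ ξ, (Real.fourierChar (-(ξ * (l * x))) : ℂ) *
        (l * φ ξ * laplace τ (σ + Complex.I * ((-(2 * Real.pi * l) * ξ : ℝ) : ℂ))) := by
  have hsw : Integrable (Function.uncurry fun u ξ : ℝ =>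
      ((τ u * Real.exp (-σ * u) : ℝ) : ℂ) *
        (l * ((Real.fourierChar (-(ξ * (l * (x - u)))) : ℂ) * φ ξ)))
      ((volume : Measure ℝ).prod volume) := by
    have h1 := (hi.ofReal (𝕜 := ℂ)).mul_prod (hk.integrable_dual.const_mul (l : ℂ))
    refine h1.mono ?_ (Eventually.of_forall fun p => ?_)
    · apply Measurable.aestronglyMeasurable
      have := hk.continuous_dual.measurable
      have h2 : Measurable fun y : ℝ => ((Real.fourierChar y : Circle) : ℂ) :=
        (continuous_subtype_val.comp Real.continuous_fourierChar).measurable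
      have h3 : Measurable fun p : ℝ × ℝ => (Real.fourierChar (-(p.2 * (l * (x - p.1)))) : ℂ) :=
        h2.comp (by fun_prop)
      unfold Function.uncurry
      fun_prop
    · simp [Function.uncurry, Circle.norm_coe]
  calc ∫ u, ((τ u * Real.exp (-σ * u) : ℝ) : ℂ) * (l * k (l * (x - u)))
      = ∫ u, ∫ ξ, ((τ u * Real.exp (-σ * u) : ℝ) : ℂ) *
        (l * ((Real.fourierChar (-(ξ * (l * (x - u)))) : ℂ) * φ ξ)) := by
        simp_rw [integral_const_mul, ← hk.eq_integral]
    _ = ∫ ξ, ∫ u, ((τ u * Real.exp (-σ * u) : ℝ) : ℂ) *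
        (l * ((Real.fourierChar (-(ξ * (l * (x - u)))) : ℂ) * φ ξ)) :=
        integral_integral_swap hsw
    _ = _ := by
        congr 1
        ext ξ
        rw [laplace, ← integral_const_mul, ← integral_const_mul]
        congr 1
        ext u
        simp only [Real.fourierChar_apply]
        push_cast
        have : Complex.exp (2 * Real.pi * -(ξ * (l * (x - u))) * Complex.I) *
            Complex.exp (-σ * u) =
            Complex.exp (2 * Real.pi * -(ξ * (l * x)) * Complex.I) *
            Complex.exp (-(σ + Complex.I * (-(2 * Real.pi * l) * ξ)) * u) := by
          rw [← Complex.exp_add, ← Complex.exp_add]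
          congr 1
          ring
        linear_combination (τ u : ℂ) * l * φ ξ * this

theorem ae_comp_mul_left {p : ℝ → Prop} (hp : ∀ᵐ t, p t) {c : ℝ} (hc : c ≠ 0) :
    ∀ᵐ t, p (c * t) := by
  have h : Measure.QuasiMeasurePreserving (fun t : ℝ => c * t) volume volume :=
    ⟨by fun_prop, by
      rw [Real.map_volume_mul_left hc]
      exact Measure.smul_absolutelyContinuous⟩
  exact h.ae hp

/-- For σ > 0 the smoothed τ(u)e^(-σu) is a Fourier integral of the Laplace transform cut off by φ,
and g dominates it on the support of φ uniformly in σ. As σ → 0 the left side converges by dominated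
convergence, which puts the limit in the scope of `tendsto_zero_of_dominated_fourier`. -/
theorem smoothed_tendsto_zero {τ : ℝ → ℝ} (hτm : Measurable τ)
    (hτ0 : ∀ u < 0, τ u = 0) {C : ℝ} (hC : ∀ u v, |τ v - τ u| ≤ C * (1 + |v - u|))
    (hL : ∀ T > 0, ∃ g : ℝ → ℝ, Integrable g ∧ ∀ σ : ℝ, 0 < σ → σ < 1 →
      ∀ᵐ t : ℝ, |t| < T → ‖laplace τ (σ + Complex.I * (t : ℂ))‖ ≤ g t)
    {φ k : ℝ → ℂ} (hk : IsBandLimitedKernel φ k) {l : ℝ} (hl : 0 < l) :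
    Tendsto (fun x => ∫ u, (τ u : ℂ) * (l * k (l * (x - u)))) atTop (𝓝 0) := by
  have h0 : 0 ≤ C := by simpa using hC 0 0
  have hpi := Real.pi_pos
  obtain ⟨g, hg, hgb⟩ := hL (2 * Real.pi * l + 1) (by positivity)
  have hc : -(2 * Real.pi * l) ≠ 0 := neg_ne_zero.mpr (by positivity)
  -- The shift by 2 keeps every s n strictly inside (0, 1), where the majorant is available.
  let s : ℕ → ℝ := fun n => 1 / ((n : ℝ) + 2)
  have hs0 : ∀ n, 0 < s n := fun n => by positivity
  have hs1 : ∀ n, s n < 1 := fun n => by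
    simp only [s]
    rw [div_lt_one (by positivity)]
    have : (0 : ℝ) ≤ n := n.cast_nonneg
    linarith
  have hst : Tendsto s atTop (𝓝 0) := by
    refine tendsto_const_nhds.div_atTop ?_
    exact tendsto_atTop_add_const_right _ _ tendsto_natCast_atTop_atTop
  let h : ℕ → ℝ → ℂ := fun n ξ =>
    l * φ ξ * laplace τ (s n + Complex.I * ((-(2 * Real.pi * l) * ξ : ℝ) : ℂ))
  -- The variable is rescaled to y = l x so that the phase ξ(l x) becomes ξ y.
  let J : ℝ → ℂ := fun y => ∫ u, (τ u : ℂ) * (l * k (l * (y / l - u)))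
  have hmain : Tendsto J atTop (𝓝 0) := by
    refine tendsto_zero_of_dominated_fourier (g := fun ξ => l * |g (-(2 * Real.pi * l) * ξ)|)
      (h := h) ((hg.abs.comp_mul_left' hc).const_mul l) (fun n => ?_) (fun n => ?_) (fun y => ?_)
    · have h1 : StronglyMeasurable fun ξ : ℝ =>
          laplace τ (s n + Complex.I * ((-(2 * Real.pi * l) * ξ : ℝ) : ℂ)) := by
        unfold laplace
        apply StronglyMeasurable.integral_prod_right (f := fun (ξ : ℝ) (u : ℝ) => (τ u : ℂ) *
          Complex.exp (-(s n + Complex.I * ((-(2 * Real.pi * l) * ξ : ℝ) : ℂ)) * u))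
        apply Measurable.stronglyMeasurable
        unfold Function.uncurry
        fun_prop
      exact ((continuous_const.mul hk.continuous_dual).aestronglyMeasurable.mul
        h1.aestronglyMeasurable)
    · filter_upwards [ae_comp_mul_left (hgb (s n) (hs0 n) (hs1 n)) hc] with ξ hξ
      simp only [h, norm_mul, Complex.norm_real, Real.norm_of_nonneg hl.le]
      rcases lt_or_ge |ξ| 1 with h1 | h1
      · have h2 := hξ (by
          rw [abs_mul, abs_neg, abs_of_pos (by positivity : 0 < 2 * Real.pi * l)]
          nlinarith [mul_pos hpi hl])
        rw [mul_assoc]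
        gcongr
        calc _ ≤ 1 * g (-(2 * Real.pi * l) * ξ) := by
              gcongr
              · exact hk.norm_dual_le ξ
          _ ≤ _ := by rw [one_mul]; exact le_abs_self _
      · rw [hk.dual_eq_zero ξ h1, norm_zero, mul_zero, zero_mul]
        positivity
    · have h1 : ∀ n, ∫ ξ, (Real.fourierChar (-(ξ * y)) : ℂ) * h n ξ =
          ∫ u, ((τ u * Real.exp (-s n * u) : ℝ) : ℂ) * (l * k (l * (y / l - u))) := by
        intro n
        rw [integral_mul_kernel_eq hτm
          (integrable_mul_exp_of_abs_sub_le hτm hτ0 hC (hs0 n)) hk l (y / l),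
          mul_div_cancel₀ y hl.ne']
      simp_rw [h1]
      have hbi : Integrable fun u => 2 * C * (1 + |y / l| + 1 / l) * l *
          ((1 + |l * (y / l - u)|) * ‖k (l * (y / l - u))‖) := by
        refine Integrable.const_mul ?_ _
        exact ((hk.integrable_moment.comp_mul_left' hl.ne').comp_sub_left (y / l))
      refine tendsto_integral_of_dominated_convergence _ (fun n => ?_) hbi (fun n => ?_) ?_
      · have := hk.continuous.measurable
        apply Measurable.aestronglyMeasurable
        fun_prop
      · refine Eventually.of_forall fun u => ?_
        have ha : |τ u * Real.exp (-s n * u)| ≤ |τ u| := by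
          rcases lt_or_ge u 0 with hu | hu
          · simp [hτ0 u hu]
          · rw [abs_mul, abs_of_pos (Real.exp_pos _)]
            refine mul_le_of_le_one_right (abs_nonneg _) (Real.exp_le_one_iff.mpr ?_)
            nlinarith [hs0 n]
        have hb := abs_le_of_abs_sub_le hτ0 hC u
        -- The linear growth of τ is absorbed by the first moment of k.
        have hd : 1 + |u| ≤ (1 + |y / l| + 1 / l) * (1 + |l * (y / l - u)|) := by
          have h2 : |u| ≤ |y / l| + |y / l - u| := by
            have := abs_sub (y / l) (y / l - u)
            simpa using this
          rw [abs_mul, abs_of_pos hl]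
          have h3 : |y / l - u| = 1 / l * (l * |y / l - u|) := by field_simp
          have h4 : 0 ≤ l * |y / l - u| := by positivity
          have h5 : 0 < 1 / l := by positivity
          nlinarith [abs_nonneg (y / l)]
        rw [norm_mul, norm_mul, Complex.norm_real, Complex.norm_real, Real.norm_eq_abs,
          Real.norm_of_nonneg hl.le]
        calc |τ u * Real.exp (-s n * u)| * (l * ‖k (l * (y / l - u))‖)
            ≤ (2 * C * ((1 + |y / l| + 1 / l) * (1 + |l * (y / l - u)|))) *
              (l * ‖k (l * (y / l - u))‖) := by
              gcongr
              exact ha.trans (hb.trans (by gcongr))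
          _ = _ := by ring
      · refine Eventually.of_forall fun u => ?_
        refine Tendsto.mul_const _ ?_
        refine (Complex.continuous_ofReal.tendsto _).comp ?_
        have h2 : Tendsto (fun n => τ u * Real.exp (-s n * u)) atTop
            (𝓝 (τ u * Real.exp (-0 * u))) :=
          ((Real.continuous_exp.tendsto _).comp ((hst.neg).mul_const u)).const_mul _
        simpa using h2
  have h2 : Tendsto (fun x : ℝ => l * x) atTop atTop := tendsto_id.const_mul_atTop hl
  refine (hmain.comp h2).congr fun x => ?_
  simp only [J, Function.comp, mul_div_cancel_left₀ x hl.ne']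

/-- A Tauberian theorem: a slowly oscillating function whose Laplace transform has a locally
integrable majorant near the imaginary axis tends to zero. -/
theorem tendsto_zero_of_slowlyOscillating {τ : ℝ → ℝ} (hτm : Measurable τ)
    (hτ0 : ∀ u < 0, τ u = 0) {C : ℝ} (hC : ∀ u v, |τ v - τ u| ≤ C * (1 + |v - u|))
    (hslow : ∀ ε > 0, ∃ δ > 0, ∃ U, ∀ u ≥ U, ∀ v ≥ u, v ≤ u + δ → |τ v - τ u| ≤ ε)
    (hL : ∀ T > 0, ∃ g : ℝ → ℝ, Integrable g ∧ ∀ σ : ℝ, 0 < σ → σ < 1 →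
      ∀ᵐ t : ℝ, |t| < T → ‖laplace τ (σ + Complex.I * (t : ℂ))‖ ≤ g t) :
    Tendsto τ atTop (𝓝 0) := by
  obtain ⟨φ, k, hk⟩ := exists_isBandLimitedKernel
  have h0 : 0 ≤ C := by simpa using hC 0 0
  have hki : Integrable k := by
    refine hk.integrable_moment.mono hk.continuous.aestronglyMeasurable
      (Eventually.of_forall fun y => ?_)
    rw [Real.norm_of_nonneg (by positivity)]
    nlinarith [norm_nonneg (k y), mul_nonneg (abs_nonneg y) (norm_nonneg (k y))]
  set A := ∫ y, ‖k y‖ with hA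
  have hA0 : 0 ≤ A := integral_nonneg fun y => norm_nonneg _
  rw [Metric.tendsto_nhds]
  intro η hη
  set ε := η / (4 * (1 + A)) with hε
  have hε0 : 0 < ε := by positivity
  obtain ⟨δ, hδ, U, hU⟩ := hslow ε hε0
  -- the tail of the kernel
  have htail : ∃ R > 0, ∫ y in {y | R < |y|}, C * ((1 + |y|) * ‖k y‖) ≤ η / 4 := by
    have h1 : Tendsto (fun n : ℕ => ∫ y in {y | (n : ℝ) < |y|}, C * ((1 + |y|) * ‖k y‖)) atTop
        (𝓝 (∫ y in ⋂ n : ℕ, {y : ℝ | (n : ℝ) < |y|}, C * ((1 + |y|) * ‖k y‖))) := by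
      refine tendsto_setIntegral_of_antitone (fun n => ?_) (fun m n hmn y hy => ?_) ⟨0, ?_⟩
      · exact measurableSet_lt measurable_const (by fun_prop)
      · have : (m : ℝ) ≤ n := by exact_mod_cast hmn
        exact this.trans_lt hy
      · exact (hk.integrable_moment.const_mul C).integrableOn
    have h2 : ⋂ n : ℕ, {y : ℝ | (n : ℝ) < |y|} = ∅ := by
      ext y
      obtain ⟨n, hn⟩ := exists_nat_ge |y|
      simpa using ⟨n, hn⟩
    rw [h2, setIntegral_empty] at h1
    obtain ⟨n, hn, hn0⟩ := ((h1.eventually (gt_mem_nhds (by positivity : 0 < η / 4))).and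
      (eventually_gt_atTop 0)).exists
    exact ⟨n, by exact_mod_cast hn0, hn.le⟩
  obtain ⟨R, hR, hRt⟩ := htail
  -- With l ≥ R/δ, the core |y| ≤ R shifts the argument of τ by at most δ, so slow oscillation
  -- applies there. With l ≥ 1, the shift in the tail is at most |y|, so the a priori bound and the
  -- moment of k apply.
  set l := max 1 (R / δ) with hl
  have hl1 : 1 ≤ l := le_max_left _ _
  have hl0 : 0 < l := by linarith
  have hlR : R / l ≤ δ := by
    rw [div_le_iff₀ hl0]
    have := le_max_right 1 (R / δ)
    rw [← hl, div_le_iff₀ hδ] at this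
    linarith
  have hsm := smoothed_tendsto_zero hτm hτ0 hC hL hk hl0
  -- The margin δ keeps x - y/l above U throughout the core. The smoothed value, the core and the
  -- tail each contribute at most η/4.
  filter_upwards [(Metric.tendsto_nhds.mp hsm) (η / 4) (by positivity),
    eventually_ge_atTop (U + δ)] with x hx hxU
  have hsub : ∫ u, (τ u : ℂ) * (l * k (l * (x - u))) = ∫ y, (τ (x - y / l) : ℂ) * k y := by
    have h1 := integral_sub_left_eq_self
      (fun u => (τ u : ℂ) * (l * k (l * (x - u)))) volume x
    rw [← h1]
    have h2 := Measure.integral_comp_div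
      (fun y : ℝ => (τ (x - y) : ℂ) * (l * k (l * (x - (x - y))))) l
    rw [abs_of_pos hl0] at h2
    have h3 : ∫ y, (τ (x - y) : ℂ) * (l * k (l * (x - (x - y)))) =
        (l : ℂ)⁻¹ * ∫ y, (τ (x - y / l) : ℂ) * (l * k (l * (x - (x - y / l)))) := by
      have : (l : ℂ) ≠ 0 := by exact_mod_cast hl0.ne'
      rw [h2, Complex.real_smul, inv_mul_cancel_left₀ this]
    rw [h3, ← integral_const_mul]
    congr 1
    ext y
    have : (l : ℂ) ≠ 0 := by exact_mod_cast hl0.ne'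
    have h4 : l * (x - (x - y / l)) = y := by field_simp; ring
    rw [h4]
    field_simp
  have hdiff : ∀ y, ‖((τ (x - y / l) : ℂ) - τ x) * k y‖ ≤
      ε * ‖k y‖ + ({y : ℝ | R < |y|}).indicator (fun y => C * ((1 + |y|) * ‖k y‖)) y := by
    intro y
    rw [norm_mul, ← Complex.ofReal_sub, Complex.norm_real, Real.norm_eq_abs]
    have hyl : |y / l| = |y| / l := by rw [abs_div, abs_of_pos hl0]
    rcases lt_or_ge R |y| with hy | hy
    · rw [Set.indicator_of_mem (by exact hy)]
      have h1 := hC x (x - y / l)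
      have h2 : |x - y / l - x| ≤ |y| := by
        rw [show x - y / l - x = -(y / l) by ring, abs_neg, hyl]
        exact div_le_self (abs_nonneg _) hl1
      have h3 : |τ (x - y / l) - τ x| ≤ C * (1 + |y|) := h1.trans (by gcongr)
      calc _ ≤ C * (1 + |y|) * ‖k y‖ := by gcongr
        _ ≤ _ := by nlinarith [mul_nonneg hε0.le (norm_nonneg (k y))]
    · rw [Set.indicator_of_notMem (by simpa using hy), add_zero]
      have h1 : |y / l| ≤ δ := by
        rw [hyl]; exact (div_le_div_of_nonneg_right hy hl0.le).trans hlR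
      obtain ⟨h2, h3⟩ := abs_le.mp h1
      gcongr
      rcases le_total 0 (y / l) with h4 | h4
      · rw [abs_sub_comm]
        exact hU (x - y / l) (by linarith) x (by linarith) (by linarith)
      · exact hU x (by linarith) (x - y / l) (by linarith) (by linarith)
  have hmeas : MeasurableSet {y : ℝ | R < |y|} := measurableSet_lt measurable_const (by fun_prop)
  have hbi : Integrable fun y => ε * ‖k y‖ +
      ({y : ℝ | R < |y|}).indicator (fun y => C * ((1 + |y|) * ‖k y‖)) y :=
    (hki.norm.const_mul ε).add ((hk.integrable_moment.const_mul C).indicator hmeas)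
  have hdi : Integrable fun y => ((τ (x - y / l) : ℂ) - τ x) * k y := by
    refine hbi.mono' ?_ (Eventually.of_forall hdiff)
    have := hk.continuous.measurable
    apply Measurable.aestronglyMeasurable
    fun_prop
  have hsplit : (τ x : ℂ) = (∫ u, (τ u : ℂ) * (l * k (l * (x - u)))) -
      ∫ y, ((τ (x - y / l) : ℂ) - τ x) * k y := by
    have h1 : ∫ y, (τ x : ℂ) * k y = τ x := by
      rw [integral_const_mul, hk.integral_eq_one, mul_one]
    have h2 : ∫ y, (τ (x - y / l) : ℂ) * k y =
        (∫ y, ((τ (x - y / l) : ℂ) - τ x) * k y) + ∫ y, (τ x : ℂ) * k y := by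
      rw [← integral_add hdi (hki.const_mul _)]
      congr 1
      ext y
      ring
    rw [hsub, h2, h1]
    ring
  have hfin : ‖∫ y, ((τ (x - y / l) : ℂ) - τ x) * k y‖ ≤ ε * A + η / 4 := by
    refine (norm_integral_le_of_norm_le hbi (Eventually.of_forall hdiff)).trans ?_
    rw [integral_add (hki.norm.const_mul ε)
      ((hk.integrable_moment.const_mul C).indicator hmeas), integral_const_mul,
      integral_indicator hmeas]
    gcongr
  have hεA : ε * A ≤ η / 4 := by
    rw [hε, div_mul_eq_mul_div, div_le_div_iff₀ (by positivity) (by norm_num)]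
    nlinarith
  rw [dist_zero_right] at hx ⊢
  rw [← Complex.norm_real, hsplit]
  calc _ ≤ _ := norm_sub_le _ _
    _ < η := by linarith

/-! ### From the lower bound for zeta to an integrable majorant -/

theorem integrableOn_abs_sub_rpow {γ : ℝ} (hγ : γ < 1) (τ T : ℝ) :
    IntegrableOn (fun t => |t - τ| ^ (-γ)) (Set.Ioo (-T) T) := by
  have h1 : ∀ b, 0 ≤ b → IntervalIntegrable (fun t : ℝ => |t| ^ (-γ)) volume 0 b := by
    intro b hb
    refine (intervalIntegral.intervalIntegrable_rpow' (r := -γ) (by linarith)).congr ?_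
    intro t ht
    rw [Set.uIoc_of_le hb] at ht
    simp only [abs_of_pos ht.1]
  have h2 : ∀ b, IntervalIntegrable (fun t : ℝ => |t| ^ (-γ)) volume 0 b := by
    intro b
    rcases le_total 0 b with hb | hb
    · exact h1 b hb
    · have := (h1 (-b) (by linarith)).comp_mul_left (c := -1)
      simpa using this
  have h3 : IntervalIntegrable (fun t : ℝ => |t - τ| ^ (-γ)) volume (-T) T := by
    have := ((h2 (-T - τ)).symm.trans (h2 (T - τ))).comp_sub_right τ
    simpa using this
  rcases lt_or_ge T 0 with hT | hT
  · rw [Set.Ioo_eq_empty (by linarith)]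
    exact integrableOn_empty
  · exact ((intervalIntegrable_iff_integrableOn_Ioc_of_le (by linarith)).mp h3).mono_set
      Set.Ioo_subset_Ioc_self

/-- A product of powers with different singularities is dominated by the sum of its factors. -/
theorem prod_abs_sub_rpow_le (S : Finset ℝ) {γ : ℝ → ℝ} (hγ : ∀ τ ∈ S, 0 ≤ γ τ) :
    ∃ C : ℝ, 0 ≤ C ∧ ∀ t, ∏ τ ∈ S, |t - τ| ^ (-γ τ) ≤ C * (1 + ∑ τ ∈ S, |t - τ| ^ (-γ τ)) := by
  induction S using Finset.induction_on with
  | empty => exact ⟨1, zero_le_one, fun t => by simp⟩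
  | insert τ₀ S h₀ ih =>
    obtain ⟨C, hC, hb⟩ := ih fun τ hτ => hγ τ (Finset.mem_insert_of_mem hτ)
    have hγ₀ := hγ τ₀ (Finset.mem_insert_self _ _)
    -- products of two factors
    have h2 : ∀ τ ∈ S, ∃ D : ℝ, 0 ≤ D ∧ ∀ t, |t - τ₀| ^ (-γ τ₀) * |t - τ| ^ (-γ τ) ≤
        D * (|t - τ₀| ^ (-γ τ₀) + |t - τ| ^ (-γ τ)) := by
      intro τ hτ
      have hne : τ ≠ τ₀ := fun h => h₀ (h ▸ hτ)
      have hδ : 0 < |τ - τ₀| / 2 := by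
        have := abs_pos.mpr (sub_ne_zero.mpr hne)
        positivity
      -- Every t is at distance at least δ from one of the two singularities, so one factor is at
      -- most its value at distance δ.
      set δ := |τ - τ₀| / 2 with hδd
      have hγτ := hγ τ (Finset.mem_insert_of_mem hτ)
      have e1 : 0 < δ ^ (-γ τ₀) := Real.rpow_pos_of_pos hδ _
      have e2 : 0 < δ ^ (-γ τ) := Real.rpow_pos_of_pos hδ _
      refine ⟨δ ^ (-γ τ₀) + δ ^ (-γ τ), by positivity, fun t => ?_⟩
      have e3 : 0 ≤ |t - τ₀| ^ (-γ τ₀) := by positivity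
      have e4 : 0 ≤ |t - τ| ^ (-γ τ) := by positivity
      have htri : |τ - τ₀| ≤ |t - τ₀| + |t - τ| := by
        have := abs_sub (t - τ₀) (t - τ)
        rwa [show t - τ₀ - (t - τ) = τ - τ₀ by ring] at this
      rcases le_total δ |t - τ₀| with h | h
      · have := Real.rpow_le_rpow_of_nonpos hδ h (neg_nonpos.mpr hγ₀)
        nlinarith
      · have h' : δ ≤ |t - τ| := by linarith
        have := Real.rpow_le_rpow_of_nonpos hδ h' (neg_nonpos.mpr hγτ)
        nlinarith
    choose! D hD0 hD using h2
    have hDs : 0 ≤ ∑ τ ∈ S, D τ := Finset.sum_nonneg hD0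
    refine ⟨C * (1 + ∑ τ ∈ S, D τ), by positivity, fun t => ?_⟩
    rw [Finset.prod_insert h₀, Finset.sum_insert h₀]
    set A := |t - τ₀| ^ (-γ τ₀) with hA
    have hA0 : 0 ≤ A := by positivity
    have hB0 : ∀ τ ∈ S, 0 ≤ |t - τ| ^ (-γ τ) := fun τ _ => by positivity
    have hBs : 0 ≤ ∑ τ ∈ S, |t - τ| ^ (-γ τ) := Finset.sum_nonneg hB0
    have h3 : A * ∑ τ ∈ S, |t - τ| ^ (-γ τ) ≤
        (∑ τ ∈ S, D τ) * (A + ∑ τ ∈ S, |t - τ| ^ (-γ τ)) := by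
      rw [Finset.mul_sum, Finset.sum_mul]
      refine Finset.sum_le_sum fun τ hτ => (hD τ hτ t).trans ?_
      have := Finset.single_le_sum hB0 hτ
      have := hD0 τ hτ
      gcongr
    calc A * ∏ τ ∈ S, |t - τ| ^ (-γ τ)
        ≤ A * (C * (1 + ∑ τ ∈ S, |t - τ| ^ (-γ τ))) := by
          gcongr
          exact hb t
      _ = C * (A + A * ∑ τ ∈ S, |t - τ| ^ (-γ τ)) := by ring
      _ ≤ C * ((1 + ∑ τ ∈ S, D τ) * (1 + (A + ∑ τ ∈ S, |t - τ| ^ (-γ τ)))) := by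
          gcongr
          nlinarith
      _ = _ := by ring

/-- The lower bound for `Z` bounds `1 / (s Z (1 + s))` by a product of powers. -/
theorem norm_le_prod_of_lowerBound {Z G : ℂ → ℂ}
    (hG : ∀ s : ℂ, 0 < s.re → s * Z (1 + s) * G s = 1) {S : Finset ℝ} {β : ℝ → ℝ} {K T σ t : ℝ}
    (hS : ∀ τ ∈ S, 0 < τ ∧ τ < T) (ht0 : 0 < t) (htT : t < T) (htS : t ∉ S)
    (hσ0 : 0 < σ) (hσ1 : σ < 1)
    (hb : Real.log ‖Z (((1 + σ : ℝ) : ℂ) + Complex.I * (t : ℂ))‖ >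
      -K - Real.log ‖((1 + σ : ℝ) : ℂ) - 1 + Complex.I * (t : ℂ)‖
        + ∑ τ ∈ S, β τ * Real.log ‖((1 + σ : ℝ) : ℂ) - 1 + Complex.I * ((t : ℂ) - (τ : ℂ))‖) :
    ‖G (σ + Complex.I * (t : ℂ))‖ ≤
      Real.exp (K + ∑ τ ∈ S, (max (β τ) 0 - β τ) * Real.log (1 + T)) *
        ∏ τ ∈ S, |t - τ| ^ (-max (β τ) 0) := by
  set s : ℂ := σ + Complex.I * (t : ℂ) with hs
  have hsre : s.re = σ := by simp [hs]
  have h1 := hG s (by rw [hsre]; exact hσ0)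
  have hs0 : s ≠ 0 := fun h => by rw [h] at h1; simp at h1
  have hZ0 : Z (1 + s) ≠ 0 := fun h => by rw [h] at h1; simp at h1
  have hG0 : G s ≠ 0 := fun h => by rw [h] at h1; simp at h1
  have e1 : ((1 + σ : ℝ) : ℂ) + Complex.I * (t : ℂ) = 1 + s := by rw [hs]; push_cast; ring
  have e2 : ((1 + σ : ℝ) : ℂ) - 1 + Complex.I * (t : ℂ) = s := by rw [hs]; push_cast; ring
  rw [e1, e2] at hb
  have h2 : Real.log ‖s‖ + Real.log ‖Z (1 + s)‖ + Real.log ‖G s‖ = 0 := by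
    rw [← Real.log_mul (norm_ne_zero_iff.mpr hs0) (norm_ne_zero_iff.mpr hZ0),
      ← Real.log_mul (by positivity) (norm_ne_zero_iff.mpr hG0), ← norm_mul, ← norm_mul, h1]
    simp
  -- Write -β = (max(β,0) - β) - max(β,0). The first, nonnegative coefficient is paired with |w| ≤ 1
  -- + T, the second with |w| ≥ |t - τ|; both bounds are free of σ.
  have h3 : ∀ τ ∈ S,
      -(β τ * Real.log ‖((1 + σ : ℝ) : ℂ) - 1 + Complex.I * ((t : ℂ) - (τ : ℂ))‖) ≤
      (max (β τ) 0 - β τ) * Real.log (1 + T) + -max (β τ) 0 * Real.log |t - τ| := by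
    intro τ hτ
    obtain ⟨hτ0, hτT⟩ := hS τ hτ
    have hne : t - τ ≠ 0 := sub_ne_zero.mpr fun h => htS (h ▸ hτ)
    set w : ℂ := ((1 + σ : ℝ) : ℂ) - 1 + Complex.I * ((t : ℂ) - (τ : ℂ)) with hw
    have hwe : w = (σ : ℂ) + Complex.I * ((t - τ : ℝ) : ℂ) := by rw [hw]; push_cast; ring
    have him : w.im = t - τ := by simp [hwe]
    have hlow : |t - τ| ≤ ‖w‖ := him ▸ Complex.abs_im_le_norm w
    have hup : ‖w‖ ≤ 1 + T := by
      rw [hwe]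
      refine (norm_add_le _ _).trans ?_
      rw [norm_mul, Complex.norm_I, one_mul, Complex.norm_real, Complex.norm_real,
        Real.norm_eq_abs, Real.norm_eq_abs, abs_of_pos hσ0]
      have : |t - τ| ≤ T := abs_le.mpr ⟨by linarith, by linarith⟩
      linarith
    have l1 : Real.log |t - τ| ≤ Real.log ‖w‖ := Real.log_le_log (abs_pos.mpr hne) hlow
    have l2 : Real.log ‖w‖ ≤ Real.log (1 + T) :=
      Real.log_le_log ((abs_pos.mpr hne).trans_le hlow) hup
    have m1 : 0 ≤ max (β τ) 0 := le_max_right _ _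
    have m2 : 0 ≤ max (β τ) 0 - β τ := sub_nonneg.mpr (le_max_left _ _)
    nlinarith [mul_le_mul_of_nonneg_left l1 m1, mul_le_mul_of_nonneg_left l2 m2]
  have h4 := Finset.sum_le_sum h3
  rw [Finset.sum_neg_distrib, Finset.sum_add_distrib] at h4
  have h5 : Real.log ‖G s‖ ≤ (K + ∑ τ ∈ S, (max (β τ) 0 - β τ) * Real.log (1 + T)) +
      ∑ τ ∈ S, -max (β τ) 0 * Real.log |t - τ| := by linarith
  rw [← Real.exp_log (norm_pos_iff.mpr hG0)]
  refine (Real.exp_le_exp.mpr h5).trans_eq ?_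
  rw [Real.exp_add, Real.exp_sum]
  congr 1
  refine Finset.prod_congr rfl fun τ hτ => ?_
  have hne : t - τ ≠ 0 := sub_ne_zero.mpr fun h => htS (h ▸ hτ)
  rw [Real.rpow_def_of_pos (abs_pos.mpr hne), mul_comm]

/-- If `Z` satisfies the lower bound, then `1 / (s Z (1 + s))` has a locally integrable majorant
near the imaginary axis. -/
theorem exists_integrable_majorant {Z G : ℂ → ℂ} (hZ : ZetaLowerBound Z)
    (hG : ∀ s : ℂ, 0 < s.re → s * Z (1 + s) * G s = 1) (hconj : ∀ s, G (conj s) = conj (G s))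
    (T : ℝ) (hT : 0 < T) :
    ∃ g : ℝ → ℝ, Integrable g ∧ ∀ σ : ℝ, 0 < σ → σ < 1 →
      ∀ᵐ t : ℝ, |t| < T → ‖G (σ + Complex.I * (t : ℂ))‖ ≤ g t := by
  obtain ⟨S₀, β, hS, hpos, hβ, hbd⟩ := hZ
  obtain ⟨K, -, hK⟩ := hbd T hT
  set S := (hS T).toFinset with hSd
  have hmem : ∀ τ ∈ S, τ ∈ S₀ ∧ τ < T := fun τ hτ => by simpa [hSd] using hτ
  set γ : ℝ → ℝ := fun τ => max (β τ) 0 with hγ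
  obtain ⟨C, hC, hCb⟩ := prod_abs_sub_rpow_le S (γ := γ) fun τ _ => le_max_right _ _
  set E := Real.exp (K + ∑ τ ∈ S, (max (β τ) 0 - β τ) * Real.log (1 + T)) with hE
  have hE0 : 0 < E := Real.exp_pos _
  have key : ∀ σ : ℝ, 0 < σ → σ < 1 → ∀ t : ℝ, 0 < t → t < T → t ∉ S →
      ‖G (σ + Complex.I * (t : ℂ))‖ ≤ E * (C * (1 + ∑ τ ∈ S, |t - τ| ^ (-γ τ))) := by
    intro σ h0 h1 t ht0 htT htS
    refine (norm_le_prod_of_lowerBound hG (fun τ hτ => ⟨hpos τ (hmem τ hτ).1, (hmem τ hτ).2⟩)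
      ht0 htT htS h0 h1 (hK t ht0 htT (1 + σ) (by linarith) (by linarith))).trans ?_
    exact mul_le_mul_of_nonneg_left (hCb t) hE0.le
  have hγ1 : ∀ τ ∈ S, γ τ < 1 := fun τ hτ => max_lt (hβ τ (hmem τ hτ).1) zero_lt_one
  -- The lower bound concerns t > 0 only. Conjugation symmetry of G carries it to t < 0, which adds
  -- the mirrored singularities -τ.
  refine ⟨(Set.Ioo (-T) T).indicator fun t =>
    E * (C * (1 + ∑ τ ∈ S, (|t - τ| ^ (-γ τ) + |t - -τ| ^ (-γ τ)))), ?_, ?_⟩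
  · rw [integrable_indicator_iff measurableSet_Ioo]
    refine Integrable.const_mul (Integrable.const_mul (Integrable.add ?_ ?_) _) _
    · exact integrableOn_const (by simp)
    · exact integrable_finsetSum _ fun τ hτ => (integrableOn_abs_sub_rpow (hγ1 τ hτ) τ T).add
        (integrableOn_abs_sub_rpow (hγ1 τ hτ) (-τ) T)
  · intro σ hσ0 hσ1
    -- At the finitely many points ±τ the real power takes a default value and gives no bound, and t
    -- = 0 is not covered by the hypothesis; all are discarded as a null set.
    have hfin : (((S : Set ℝ) ∪ (fun x => -x) '' (S : Set ℝ)) ∪ {0}).Finite :=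
      (S.finite_toSet.union (S.finite_toSet.image _)).union (Set.finite_singleton 0)
    filter_upwards [hfin.countable.ae_notMem volume] with t ht htT
    simp only [Set.mem_union, Set.mem_singleton_iff, not_or, Finset.mem_coe, Set.mem_image,
      not_exists, not_and] at ht
    obtain ⟨⟨ht1, ht2⟩, ht3⟩ := ht
    rw [Set.indicator_of_mem (Set.mem_Ioo.mpr (abs_lt.mp htT))]
    rcases lt_or_gt_of_ne ht3 with hneg | hposi
    · have h1 := key σ hσ0 hσ1 (-t) (by linarith) (by linarith [(abs_lt.mp htT).1])
        (fun h => ht2 _ h (by ring))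
      have h2 : G (σ + Complex.I * (t : ℂ)) = conj (G (σ + Complex.I * ((-t : ℝ) : ℂ))) := by
        rw [← hconj]
        congr 1
        simp
      rw [h2, RCLike.norm_conj]
      refine h1.trans ?_
      gcongr with τ hτ
      rw [show |-t - τ| = |t - -τ| by rw [← abs_neg]; congr 1; ring]
      exact le_add_of_nonneg_left (by positivity)
    · refine (key σ hσ0 hσ1 t hposi (abs_lt.mp htT).2 ht1).trans ?_
      gcongr with τ hτ
      exact le_add_of_nonneg_right (by positivity)

/-! ### Measures of linear growth and their logarithmic means -/

/-- A measure carried by `[1, ∞)` with linearly growing distribution function. -/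
structure HasLinearGrowth (ν : Measure ℝ) (C : ℝ) : Prop where
  measure_Iio : ν (Set.Iio 1) = 0
  measure_Iic_le : ∀ x, 0 < x → ν (Set.Iic x) ≤ ENNReal.ofReal (C * x)

theorem HasLinearGrowth.mono {ν μ : Measure ℝ} {C : ℝ} (h : HasLinearGrowth ν C) (hμ : μ ≤ ν) :
    HasLinearGrowth μ C :=
  ⟨le_zero_iff.mp ((hμ _).trans_eq h.measure_Iio), fun x hx => (hμ _).trans (h.measure_Iic_le x hx)⟩

theorem HasLinearGrowth.ae_one_le {ν : Measure ℝ} {C : ℝ} (h : HasLinearGrowth ν C) :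
    ∀ᵐ x ∂ν, 1 ≤ x := by
  have := h.measure_Iio
  rw [measure_eq_zero_iff_ae_notMem] at this
  filter_upwards [this] with x hx
  simpa using hx

theorem HasLinearGrowth.measure_Iic_lt_top {ν : Measure ℝ} {C : ℝ} (h : HasLinearGrowth ν C)
    (x : ℝ) : ν (Set.Iic x) < ⊤ :=
  (measure_mono (Set.Iic_subset_Iic.mpr (le_max_left x 1))).trans_lt
    ((h.measure_Iic_le (max x 1) (by positivity)).trans_lt ENNReal.ofReal_lt_top)

theorem HasLinearGrowth.sigmaFinite {ν : Measure ℝ} {C : ℝ} (h : HasLinearGrowth ν C) :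
    SigmaFinite ν :=
  ⟨⟨⟨fun n : ℕ => Set.Iic (n : ℝ), fun _ => trivial, fun n => h.measure_Iic_lt_top n, by
    ext x
    obtain ⟨n, hn⟩ := exists_nat_ge x
    simpa using ⟨n, hn⟩⟩⟩⟩

/-- Layer-cake formula: the set where x^(-p) ≥ y has measure at most C y^(-1/p) for y ≤ 1 and zero
for y > 1, and 1/p < 1 makes this integrable at 0. -/
theorem HasLinearGrowth.integrable_rpow {ν : Measure ℝ} {C : ℝ} (h : HasLinearGrowth ν C)
    {p : ℝ} (hp : 1 < p) : Integrable (fun x => x ^ (-p)) ν := by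
  have hp0 : 0 < p := by linarith
  have hnn : 0 ≤ᵐ[ν] fun x => x ^ (-p) := h.ae_one_le.mono fun x hx =>
    Real.rpow_nonneg (by linarith) _
  have hm : Measurable fun x : ℝ => x ^ (-p) := by fun_prop
  refine ⟨hm.aestronglyMeasurable, ?_⟩
  rw [hasFiniteIntegral_iff_ofReal hnn, lintegral_eq_lintegral_meas_le ν hnn hm.aemeasurable]
  have hb : ∀ y ∈ Set.Ioi (0 : ℝ), ν {x | y ≤ x ^ (-p)} ≤
      (Set.Ioc (0 : ℝ) 1).indicator (fun y => ENNReal.ofReal (C * y ^ (-(1 / p)))) y := by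
    intro y hy
    have hy : 0 < y := hy
    by_cases hy1 : y ≤ 1
    · rw [Set.indicator_of_mem (Set.mem_Ioc.mpr ⟨hy, hy1⟩)]
      refine (measure_mono_ae ?_).trans (h.measure_Iic_le _ (Real.rpow_pos_of_pos hy _))
      filter_upwards [h.ae_one_le] with x hx hxy
      have hxy : y ≤ x ^ (-p) := hxy
      have hx0 : 0 < x := by linarith
      have := Real.rpow_le_rpow_of_nonpos hy hxy (by
        rw [neg_nonpos]; positivity : -(1 / p) ≤ 0)
      rw [← Real.rpow_mul hx0.le, show -p * -(1 / p) = 1 by field_simp, Real.rpow_one] at this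
      exact this
    · rw [Set.indicator_of_notMem (by simpa [hy] using hy1)]
      refine le_of_eq ?_
      rw [measure_eq_zero_iff_ae_notMem]
      filter_upwards [h.ae_one_le] with x hx hxy
      have hxy : y ≤ x ^ (-p) := hxy
      exact hy1 (hxy.trans (Real.rpow_le_one_of_one_le_of_nonpos hx (by linarith)))
  refine (setLIntegral_mono' measurableSet_Ioi hb).trans_lt ?_
  rw [lintegral_indicator measurableSet_Ioc]
  rw [Measure.restrict_restrict measurableSet_Ioc, Set.inter_eq_left.mpr (fun x hx => hx.1)]
  have hi : IntegrableOn (fun y : ℝ => C * y ^ (-(1 / p))) (Set.Ioc 0 1) := by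
    rw [← intervalIntegrable_iff_integrableOn_Ioc_of_le zero_le_one]
    refine (intervalIntegral.intervalIntegrable_rpow' ?_).const_mul C
    rw [neg_lt_neg_iff, div_lt_one hp0]
    exact hp
  exact hi.lintegral_lt_top

theorem norm_ofReal_cpow_neg {x : ℝ} (hx : 1 ≤ x) (s : ℂ) : ‖(x : ℂ) ^ (-s)‖ = x ^ (-s.re) := by
  rw [Complex.norm_cpow_eq_rpow_re_of_pos (by linarith), Complex.neg_re]

theorem measurable_ofReal_cpow (s : ℂ) : Measurable fun x : ℝ => (x : ℂ) ^ s :=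
  Complex.measurable_ofReal.pow_const s

theorem HasLinearGrowth.integrable_cpow {ν : Measure ℝ} {C : ℝ} (h : HasLinearGrowth ν C)
    {s : ℂ} (hs : 1 < s.re) : Integrable (fun x : ℝ => (x : ℂ) ^ (-s)) ν := by
  refine (h.integrable_rpow hs).mono' (measurable_ofReal_cpow _).aestronglyMeasurable ?_
  filter_upwards [h.ae_one_le] with x hx
  exact (norm_ofReal_cpow_neg hx s).le

/-- `∫_{1^-}^{e^u} t^{-1} dν(t)`. -/
def logMean (ν : Measure ℝ) (u : ℝ) : ℝ := ∫ t in Set.Icc 1 (Real.exp u), t⁻¹ ∂ν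

theorem HasLinearGrowth.integrableOn_inv {ν : Measure ℝ} {C : ℝ} (h : HasLinearGrowth ν C)
    (x : ℝ) : IntegrableOn (fun t => t⁻¹) (Set.Icc 1 x) ν := by
  refine Measure.integrableOn_of_bounded (M := 1)
    ((measure_mono Set.Icc_subset_Iic_self).trans_lt (h.measure_Iic_lt_top x)).ne
    measurable_inv.aestronglyMeasurable ?_
  filter_upwards [ae_restrict_mem measurableSet_Icc] with t ht
  rw [norm_inv, Real.norm_of_nonneg (by linarith [ht.1])]
  exact inv_le_one_of_one_le₀ ht.1

theorem logMean_eq_zero (ν : Measure ℝ) {u : ℝ} (hu : u < 0) : logMean ν u = 0 := by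
  rw [logMean, Set.Icc_eq_empty (by simpa using hu), setIntegral_empty]

theorem HasLinearGrowth.logMean_sub {ν : Measure ℝ} {C : ℝ} (h : HasLinearGrowth ν C) {u v : ℝ}
    (huv : u ≤ v) : 0 ≤ logMean ν v - logMean ν u ∧ logMean ν v - logMean ν u ≤
      Real.exp (-u) * (ν (Set.Ioc (Real.exp u) (Real.exp v))).toReal := by
  have he := Real.exp_le_exp.mpr huv
  have hsub : Set.Icc 1 (Real.exp u) ⊆ Set.Icc 1 (Real.exp v) := Set.Icc_subset_Icc_right he
  have h1 : logMean ν v - logMean ν u =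
      ∫ t in Set.Icc 1 (Real.exp v) \ Set.Icc 1 (Real.exp u), t⁻¹ ∂ν := by
    rw [setIntegral_sdiff measurableSet_Icc (h.integrableOn_inv _) hsub]
    rfl
  have hsub2 : Set.Icc 1 (Real.exp v) \ Set.Icc 1 (Real.exp u) ⊆
      Set.Ioc (Real.exp u) (Real.exp v) := by
    rintro t ⟨⟨h1, h2⟩, h3⟩
    refine ⟨?_, h2⟩
    by_contra! h4
    exact h3 ⟨h1, h4⟩
  have hms : MeasurableSet (Set.Icc 1 (Real.exp v) \ Set.Icc 1 (Real.exp u)) :=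
    measurableSet_Icc.diff measurableSet_Icc
  have hfin : ν (Set.Ioc (Real.exp u) (Real.exp v)) < ⊤ :=
    (measure_mono Set.Ioc_subset_Iic_self).trans_lt (h.measure_Iic_lt_top _)
  rw [h1]
  refine ⟨setIntegral_nonneg hms fun t ht => inv_nonneg.mpr (by linarith [ht.1.1]), ?_⟩
  have h2 := norm_setIntegral_le_of_norm_le_const (μ := ν) (C := Real.exp (-u)) (f := fun t => t⁻¹)
    ((measure_mono hsub2).trans_lt hfin) (fun t ht => by
      rw [norm_inv, Real.norm_of_nonneg (by linarith [ht.1.1]), Real.exp_neg]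
      exact inv_anti₀ (Real.exp_pos u) (hsub2 ht).1.le)
  refine (le_abs_self _).trans (h2.trans ?_)
  gcongr
  exact ENNReal.toReal_mono hfin.ne (measure_mono hsub2)

theorem HasLinearGrowth.monotone_logMean {ν : Measure ℝ} {C : ℝ} (h : HasLinearGrowth ν C) :
    Monotone (logMean ν) := fun _ _ huv => sub_nonneg.mp (h.logMean_sub huv).1

/-- Chain ⌈v - u⌉ steps of length at most 1. -/
theorem abs_sub_le_of_unit_step {τ : ℝ → ℝ} {C : ℝ}
    (h : ∀ u v, u ≤ v → v ≤ u + 1 → |τ v - τ u| ≤ C) (u v : ℝ) :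
    |τ v - τ u| ≤ C * (1 + |v - u|) := by
  have hC : 0 ≤ C := by simpa using h 0 0 le_rfl (by norm_num)
  have h1 : ∀ n : ℕ, ∀ u v : ℝ, u ≤ v → v ≤ u + n → |τ v - τ u| ≤ C * n := by
    intro n
    induction n with
    | zero =>
      intro u v h1 h2
      have : u = v := le_antisymm h1 (by simpa using h2)
      simp [this]
    | succ n ih =>
      intro u v h1 h2
      push_cast at h2 ⊢
      rcases le_total v (u + n) with h3 | h3
      · exact (ih u v h1 h3).trans (by nlinarith)
      · have e1 := ih u (u + n) (by simp) le_rfl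
        have e2 := h (u + n) v h3 (by linarith)
        have := abs_sub_le (τ v) (τ (u + n)) (τ u)
        linarith
  have h2 : ∀ u v : ℝ, u ≤ v → |τ v - τ u| ≤ C * (1 + |v - u|) := by
    intro u v huv
    have e1 := Nat.le_ceil (v - u)
    have e2 := Nat.ceil_lt_add_one (sub_nonneg.mpr huv)
    refine (h1 ⌈v - u⌉₊ u v huv (by linarith)).trans ?_
    rw [abs_of_nonneg (sub_nonneg.mpr huv)]
    exact mul_le_mul_of_nonneg_left (by linarith) hC
  rcases le_total u v with huv | huv
  · exact h2 u v huv
  · rw [abs_sub_comm, abs_sub_comm v u]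
    exact h2 v u huv

theorem integral_Ici_exp_neg_mul {s : ℂ} (hs : 0 < s.re) (c : ℝ) :
    ∫ u in Set.Ici c, Complex.exp (-s * u) = Complex.exp (-s * c) / s := by
  rw [integral_Ici_eq_integral_Ioi, integral_exp_mul_complex_Ioi (by simpa using hs)]
  rw [div_neg, neg_div, neg_neg]

theorem integrableOn_Ici_exp_neg_mul {s : ℂ} (hs : 0 < s.re) (c : ℝ) :
    IntegrableOn (fun u : ℝ => Complex.exp (-s * u)) (Set.Ici c) := by
  rw [integrableOn_Ici_iff_integrableOn_Ioi]
  exact integrableOn_exp_mul_complex_Ioi (by simpa using hs) c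

/-- The Laplace transform of `logMean ν`, together with its absolute convergence. -/
theorem HasLinearGrowth.laplace_logMean {ν : Measure ℝ} {C : ℝ} (h : HasLinearGrowth ν C) {s : ℂ}
    (hs : 0 < s.re) : Integrable (fun u : ℝ => (logMean ν u : ℂ) * Complex.exp (-s * u)) ∧
      laplace (logMean ν) s = (∫ x : ℝ, (x : ℂ) ^ (-(1 + s)) ∂ν) / s := by
  have := h.sigmaFinite
  -- Fubini for t⁻¹e^(-su) on the region log t ≤ u: integrating in t first gives the logarithmic
  -- mean, in u first the Mellin kernel t^(-1-s)/s.
  let F : ℝ × ℝ → ℂ := fun p => (Set.Ici (Real.log p.1)).indicator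
    (fun u : ℝ => ((p.1⁻¹ : ℝ) : ℂ) * Complex.exp (-s * u)) p.2
  have hFm : Measurable F := by
    have : F = ({p : ℝ × ℝ | Real.log p.1 ≤ p.2}).indicator
        (fun p => ((p.1⁻¹ : ℝ) : ℂ) * Complex.exp (-s * p.2)) := by
      ext p
      simp [F, Set.indicator]
    rw [this]
    exact Measurable.indicator (by fun_prop) (measurableSet_le (by fun_prop) (by fun_prop))
  have hin : ∀ t, Integrable fun u => F (t, u) := by
    intro t
    rw [show (fun u => F (t, u)) = (Set.Ici (Real.log t)).indicator
      (fun u : ℝ => ((t⁻¹ : ℝ) : ℂ) * Complex.exp (-s * u)) from rfl,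
      integrable_indicator_iff measurableSet_Ici]
    exact (integrableOn_Ici_exp_neg_mul hs _).const_mul _
  have hint : ∀ t, 1 ≤ t → ∫ u, F (t, u) = (t : ℂ) ^ (-(1 + s)) / s := by
    intro t ht
    have ht0 : (t : ℂ) ≠ 0 := by exact_mod_cast (by linarith : t ≠ 0)
    simp only [F]
    rw [integral_indicator measurableSet_Ici, integral_const_mul, integral_Ici_exp_neg_mul hs,
      neg_add, Complex.cpow_add _ _ ht0, Complex.cpow_neg_one, Complex.cpow_def_of_ne_zero ht0,
      ← Complex.ofReal_log (by linarith)]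
    push_cast
    ring_nf
  have hnorm : ∀ t, 1 ≤ t → ∫ u, ‖F (t, u)‖ = t ^ (-(1 + s.re)) / s.re := by
    intro t ht
    have ht0 : 0 < t := by linarith
    have e1 : ∀ u, ‖F (t, u)‖ = (Set.Ici (Real.log t)).indicator
        (fun u : ℝ => t⁻¹ * Real.exp (-s.re * u)) u := by
      intro u
      simp only [F]
      rw [norm_indicator_eq_indicator_norm]
      congr 1
      ext u
      rw [norm_mul, Complex.norm_real, Complex.norm_exp, Real.norm_of_nonneg (by positivity)]
      simp
    simp_rw [e1]
    rw [integral_indicator measurableSet_Ici, integral_const_mul, integral_Ici_eq_integral_Ioi,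
      integral_exp_mul_Ioi (by linarith), neg_add, Real.rpow_add ht0, Real.rpow_neg_one,
      Real.rpow_def_of_pos ht0]
    rw [div_neg, neg_div, neg_neg, mul_comm (-s.re), mul_div_assoc]
  have hFi : Integrable F (ν.prod volume) := by
    rw [integrable_prod_iff hFm.aestronglyMeasurable]
    refine ⟨Eventually.of_forall hin, ?_⟩
    refine ((h.integrable_rpow (p := 1 + s.re) (by linarith)).div_const s.re).congr ?_
    filter_upwards [h.ae_one_le] with t ht
    exact (hnorm t ht).symm
  have hinner : ∀ u, ∫ t, F (t, u) ∂ν = (logMean ν u : ℂ) * Complex.exp (-s * u) := by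
    intro u
    have e1 : (fun t => F (t, u)) =ᵐ[ν] (Set.Icc 1 (Real.exp u)).indicator
        (fun t => ((t⁻¹ : ℝ) : ℂ) * Complex.exp (-s * u)) := by
      filter_upwards [h.ae_one_le] with t ht
      simp only [F, Set.indicator, Set.mem_Ici, Set.mem_Icc]
      have : Real.log t ≤ u ↔ 1 ≤ t ∧ t ≤ Real.exp u := by
        rw [Real.log_le_iff_le_exp (by linarith)]
        tauto
      simp only [this]
    rw [integral_congr_ae e1, integral_indicator measurableSet_Icc, integral_mul_const,
      integral_complex_ofReal]
    rfl
  constructor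
  · exact hFi.integral_prod_right.congr (Eventually.of_forall hinner)
  · rw [laplace, ← integral_div]
    simp_rw [← hinner]
    rw [← integral_integral_swap (f := fun t u => F (t, u)) hFi]
    apply integral_congr_ae
    filter_upwards [h.ae_one_le] with t ht
    exact hint t ht

theorem laplace_conj (τ : ℝ → ℝ) (s : ℂ) : laplace τ (conj s) = conj (laplace τ s) := by
  rw [laplace, laplace, ← integral_conj]
  congr 1
  ext u
  simp [← Complex.exp_conj]

theorem exists_hasLinearGrowth {ν : Measure ℝ} (h1 : ν (Set.Iio 1) = 0)
    (h2 : ∀ x, ν (Set.Iic x) ≠ ⊤) {a : ℝ}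
    (h3 : Tendsto (fun x => (ν (Set.Iic x)).toReal / x) atTop (𝓝 a)) :
    ∃ C, 0 ≤ C ∧ HasLinearGrowth ν C := by
  obtain ⟨X, hX⟩ := eventually_atTop.mp (h3.eventually (gt_mem_nhds (lt_add_one a)))
  set Y := max X 1
  have hY : 1 ≤ Y := le_max_right _ _
  have hm : ∀ x y, x ≤ y → (ν (Set.Iic x)).toReal ≤ (ν (Set.Iic y)).toReal := fun x y hxy =>
    ENNReal.toReal_mono (h2 y) (measure_mono (Set.Iic_subset_Iic.mpr hxy))
  have h0 : ∀ x, 0 ≤ (ν (Set.Iic x)).toReal := fun x => ENNReal.toReal_nonneg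
  -- The first term handles x ≥ Y, where the ratio is below a + 1; the second handles 1 ≤ x ≤ Y by
  -- monotonicity.
  refine ⟨|a + 1| + (ν (Set.Iic Y)).toReal, by positivity, h1, fun x hx => ?_⟩
  rw [← ENNReal.ofReal_toReal (h2 x)]
  rcases lt_or_ge x 1 with hx1 | hx1
  · have : ν (Set.Iic x) = 0 :=
      le_zero_iff.mp ((measure_mono (fun y (hy : y ≤ x) => hy.trans_lt hx1)).trans_eq h1)
    rw [this]
    simp
  · apply ENNReal.ofReal_le_ofReal
    rcases le_total x Y with hxY | hxY
    · have := hm x Y hxY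
      nlinarith [h0 Y, abs_nonneg (a + 1)]
    · have h4 := hX x ((le_max_left _ _).trans hxY)
      rw [div_lt_iff₀ hx] at h4
      nlinarith [h0 Y, le_abs_self (a + 1)]

/-- The main step: measures `P, Q ≤ ν` for which `P - Q` has Mellin transform `1 / Z`. -/
theorem tendsto_mean_of_mellin {ν P Q : Measure ℝ} (hν1 : ν (Set.Iio 1) = 0)
    (hνf : ∀ x, ν (Set.Iic x) ≠ ⊤) {a : ℝ} (ha : 0 < a)
    (hνa : Tendsto (fun x => (ν (Set.Iic x)).toReal / x) atTop (𝓝 a)) (hP : P ≤ ν) (hQ : Q ≤ ν)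
    {Z : ℂ → ℂ} (hZ : ZetaLowerBound Z)
    (hZi : ∀ s : ℂ, 1 < s.re →
      Z s * ((∫ x : ℝ, (x : ℂ) ^ (-s) ∂P) - ∫ x : ℝ, (x : ℂ) ^ (-s) ∂Q) = 1) :
    Tendsto (fun x => (∫ t in Set.Icc 1 x, t⁻¹ ∂P) - ∫ t in Set.Icc 1 x, t⁻¹ ∂Q) atTop (𝓝 0) := by
  obtain ⟨C, hC, hg⟩ := exists_hasLinearGrowth hν1 hνf hνa
  have hgP := hg.mono hP
  have hgQ := hg.mono hQ
  set τ : ℝ → ℝ := fun u => logMean P u - logMean Q u with hτ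
  have hτm : Measurable τ := hgP.monotone_logMean.measurable.sub hgQ.monotone_logMean.measurable
  have hτ0 : ∀ u < 0, τ u = 0 := fun u hu => by
    simp [hτ, logMean_eq_zero _ hu]
  -- The increments of both means lie in the same interval [0, e^(-u) ν(e^u, e^v]], hence so does
  -- the absolute value of their difference.
  have hinc : ∀ u v, u ≤ v → |τ v - τ u| ≤
      Real.exp (-u) * (ν (Set.Ioc (Real.exp u) (Real.exp v))).toReal := by
    intro u v huv
    have hle : ∀ {μ : Measure ℝ}, μ ≤ ν →
        Real.exp (-u) * (μ (Set.Ioc (Real.exp u) (Real.exp v))).toReal ≤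
        Real.exp (-u) * (ν (Set.Ioc (Real.exp u) (Real.exp v))).toReal := by
      intro μ hμ
      gcongr
      · exact ((measure_mono Set.Ioc_subset_Iic_self).trans_lt (hg.measure_Iic_lt_top _)).ne
    obtain ⟨p1, p2⟩ := hgP.logMean_sub huv
    obtain ⟨q1, q2⟩ := hgQ.logMean_sub huv
    have p3 := p2.trans (hle hP)
    have q3 := q2.trans (hle hQ)
    simp only [hτ]
    rw [abs_le]
    constructor <;> linarith
  have hdiff : ∀ u v, u ≤ v → (ν (Set.Ioc (Real.exp u) (Real.exp v))).toReal =
      (ν (Set.Iic (Real.exp v))).toReal - (ν (Set.Iic (Real.exp u))).toReal := by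
    intro u v huv
    rw [← Set.Iic_sdiff_Iic, measure_sdiff (Set.Iic_subset_Iic.mpr (Real.exp_le_exp.mpr huv))
      measurableSet_Iic.nullMeasurableSet (hνf _), ENNReal.toReal_sub_of_le
      (measure_mono (Set.Iic_subset_Iic.mpr (Real.exp_le_exp.mpr huv))) (hνf _)]
  have hstep : ∀ u v, |τ v - τ u| ≤ (C * Real.exp 1) * (1 + |v - u|) := by
    refine abs_sub_le_of_unit_step fun u v huv hv => (hinc u v huv).trans ?_
    have h1 : (ν (Set.Ioc (Real.exp u) (Real.exp v))).toReal ≤ C * Real.exp (u + 1) := by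
      refine ENNReal.toReal_le_of_le_ofReal (by positivity) ?_
      exact (measure_mono (fun x hx => hx.2.trans (Real.exp_le_exp.mpr hv))).trans
        (hg.measure_Iic_le _ (Real.exp_pos _))
    calc _ ≤ Real.exp (-u) * (C * Real.exp (u + 1)) := by gcongr
      _ = C * (Real.exp (-u) * Real.exp (u + 1)) := by ring
      _ = C * Real.exp 1 := by rw [← Real.exp_add]; congr 2; ring
  have hslow : ∀ ε > 0, ∃ δ > 0, ∃ U, ∀ u ≥ U, ∀ v ≥ u, v ≤ u + δ → |τ v - τ u| ≤ ε := by
    intro ε hε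
    -- With e^v ≤ (1+c)e^u and ν(Iic x)/x within η of a, the increment is at most (a+η)(1+c) - (a-η)
    -- = ac + η(2+c). The choices of c and η make each summand ε/2.
    set c := ε / (2 * a) with hc
    have hc0 : 0 < c := by positivity
    set η := ε / (2 * (2 + c)) with hη
    have hη0 : 0 < η := by positivity
    have hlim := (hνa.comp Real.tendsto_exp_atTop)
    obtain ⟨U, hU⟩ := eventually_atTop.mp ((Metric.tendsto_nhds.mp hlim) η hη0)
    refine ⟨Real.log (1 + c), Real.log_pos (by linarith), U, fun u hu v hv hvu => ?_⟩
    refine (hinc u v hv).trans ?_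
    rw [hdiff u v hv]
    have e1 := hU u hu
    have e2 := hU v (hu.le.trans hv)
    rw [Real.dist_eq, Function.comp, abs_lt] at e1 e2
    have eu := Real.exp_pos u
    have ev := Real.exp_pos v
    have f1 : (a - η) * Real.exp u ≤ (ν (Set.Iic (Real.exp u))).toReal := by
      rw [← le_div_iff₀ eu]; linarith [e1.1]
    have f2 : (ν (Set.Iic (Real.exp v))).toReal ≤ (a + η) * Real.exp v := by
      rw [← div_le_iff₀ ev]; linarith [e2.2]
    have f3 : Real.exp v ≤ Real.exp u * (1 + c) := by
      rw [← Real.exp_log (by linarith : 0 < 1 + c), ← Real.exp_add]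
      exact Real.exp_le_exp.mpr hvu
    have f4 : a * c = ε / 2 := by rw [hc]; field_simp
    have f5 : η * (2 + c) = ε / 2 := by rw [hη]; field_simp
    rw [Real.exp_neg, inv_mul_le_iff₀ eu]
    have f6 : (a + η) * Real.exp v ≤ (a + η) * (Real.exp u * (1 + c)) := by gcongr
    have f7 : (a + η) * (Real.exp u * (1 + c)) - (a - η) * Real.exp u =
        Real.exp u * (a * c + η * (2 + c)) := by ring
    rw [f4, f5] at f7
    linarith
  have hlap : ∀ s : ℂ, 0 < s.re → s * Z (1 + s) * laplace τ s = 1 := by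
    intro s hs
    obtain ⟨p1, p2⟩ := hgP.laplace_logMean hs
    obtain ⟨q1, q2⟩ := hgQ.laplace_logMean hs
    have hs0 : s ≠ 0 := fun h => by simp [h] at hs
    have e1 : laplace τ s = laplace (logMean P) s - laplace (logMean Q) s := by
      rw [laplace, laplace, laplace, ← integral_sub p1 q1]
      congr 1
      ext u
      simp only [hτ]
      push_cast
      ring
    have e2 := hZi (1 + s) (by simpa using hs)
    rw [e1, p2, q2, ← sub_div, mul_right_comm, mul_div_cancel₀ _ hs0, mul_comm, e2]
  have hfin := tendsto_zero_of_slowlyOscillating hτm hτ0 hstep hslow fun T hT =>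
    exists_integrable_majorant hZ hlap (laplace_conj τ) T hT
  refine (hfin.comp Real.tendsto_log_atTop).congr' ?_
  filter_upwards [eventually_gt_atTop 0] with x hx
  simp only [Function.comp, hτ, logMean, Real.exp_log hx]

/-! ### Discrete systems and Möbius inversion -/

namespace Primes

variable (P : Primes)

theorem int_zero : P.int 0 = 1 := Finsupp.prod_zero_index

theorem int_add (α β : ℕ →₀ ℕ) : P.int (α + β) = P.int α * P.int β :=
  Finsupp.prod_add_index' (fun _ => pow_zero _) fun _ _ _ => pow_add _ _ _

theorem one_le_int (α : ℕ →₀ ℕ) : 1 ≤ P.int α :=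
  Finset.prod_induction _ (fun y => 1 ≤ y) (fun _ _ => one_le_mul_of_one_le_of_one_le)
    le_rfl fun j _ => one_le_pow₀ (P.one_lt_p j).le

theorem moebius_zero : moebius 0 = 1 := by
  simp [moebius]

theorem moebius_eq_zero {γ : ℕ →₀ ℕ} {k : ℕ} (hk : 1 < γ k) : moebius γ = 0 := by
  rw [moebius, if_neg]
  exact fun h => (h k).not_gt hk

theorem moebius_cases (γ : ℕ →₀ ℕ) : moebius γ = 0 ∨ moebius γ = 1 ∨ moebius γ = -1 := by
  unfold moebius
  split_ifs
  · exact Or.inr (neg_one_pow_eq_or ℝ _)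
  · exact Or.inl rfl

theorem moebius_add_single {γ : ℕ →₀ ℕ} {k : ℕ} (hk : γ k = 0) :
    moebius (γ + Finsupp.single k 1) = -moebius γ := by
  classical
  have h1 : (∀ j, (γ + Finsupp.single k 1 : ℕ →₀ ℕ) j ≤ 1) ↔ ∀ j, γ j ≤ 1 := by
    refine forall_congr' fun j => ?_
    rw [Finsupp.add_apply, Finsupp.single_apply]
    split_ifs with h
    · subst h; omega
    · simp
  have h2 : ((γ + Finsupp.single k 1 : ℕ →₀ ℕ).sum fun _ e => e) = (γ.sum fun _ e => e) + 1 := by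
    rw [Finsupp.sum_add_index' (fun _ => rfl) fun _ _ _ => rfl, Finsupp.sum_single_index rfl]
  unfold moebius
  simp only [h1, h2]
  split_ifs
  · rw [pow_succ]; ring
  · simp

/-- A sign-reversing involution: fix a prime index k occurring in α, discard the pairs whose second
entry contains it at least twice (there μ = 0), and move one factor p_k from one entry to the other.
-/
theorem sum_antidiagonal_moebius (α : ℕ →₀ ℕ) :
    ∑ p ∈ Finset.HasAntidiagonal.antidiagonal α, moebius p.2 = if α = 0 then 1 else 0 := by
  classical
  split_ifs with h0
  · subst h0
    simp [moebius_zero]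
  · obtain ⟨k, hk⟩ := Finsupp.ne_iff.mp h0
    rw [Finsupp.coe_zero, Pi.zero_apply] at hk
    set S := (Finset.HasAntidiagonal.antidiagonal α).filter fun p => p.2 k ≤ 1 with hS
    have h1 : ∑ p ∈ Finset.HasAntidiagonal.antidiagonal α, moebius p.2 = ∑ p ∈ S, moebius p.2 := by
      rw [hS, Finset.sum_filter_of_ne]
      intro p _ hp
      by_contra! h
      exact hp (moebius_eq_zero h)
    have hmem : ∀ p, p ∈ S ↔ p.1 + p.2 = α ∧ p.2 k ≤ 1 := by simp [hS]
    rw [h1]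
    let e : ℕ →₀ ℕ := Finsupp.single k 1
    have hek : e k = 1 := Finsupp.single_eq_same
    have hle : ∀ γ : ℕ →₀ ℕ, γ k ≠ 0 → γ - e + e = γ := fun γ hγ =>
      tsub_add_cancel_of_le (Finsupp.single_le_iff.mpr (Nat.one_le_iff_ne_zero.mpr hγ))
    refine Finset.sum_involution
      (fun p _ => if p.2 k = 0 then (p.1 - e, p.2 + e) else (p.1 + e, p.2 - e)) ?_ ?_ ?_ ?_
    · intro p hp
      split_ifs with hz
      · simp only [e, moebius_add_single hz, add_neg_cancel]
      · have h2 : (p.2 - e) k = 0 := by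
          have := ((hmem p).mp hp).2
          rw [Finsupp.tsub_apply, hek]; omega
        have h3 := moebius_add_single h2
        rw [show p.2 - e + Finsupp.single k 1 = p.2 from hle _ hz] at h3
        simp only [h3, neg_add_cancel]
    · intro p hp _ heq
      have h2 := congrArg (fun q : (ℕ →₀ ℕ) × (ℕ →₀ ℕ) => q.2 k) heq
      split_ifs at h2 with hz
      · simp [hek] at h2
      · simp only [Finsupp.tsub_apply, hek] at h2; omega
    · intro p hp
      obtain ⟨h2, h3⟩ := (hmem p).mp hp
      rw [hmem]
      split_ifs with hz
      · have h4 : p.1 k ≠ 0 := by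
          intro h; apply hk; rw [← h2, Finsupp.add_apply, h, hz, add_zero]
        refine ⟨?_, by simp [hek, hz]⟩
        change p.1 - e + (p.2 + e) = α
        rw [add_comm p.2 e, ← add_assoc, hle _ h4, h2]
      · refine ⟨?_, by simp only [Finsupp.tsub_apply]; omega⟩
        change p.1 + e + (p.2 - e) = α
        rw [add_assoc, add_comm e, hle _ hz, h2]
    · intro p hp
      obtain ⟨h2, h3⟩ := (hmem p).mp hp
      by_cases hz : p.2 k = 0
      · have h4 : p.1 k ≠ 0 := by
          intro h; apply hk; rw [← h2, Finsupp.add_apply, h, hz, add_zero]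
        simp [hz, hek, hle _ h4]
      · have h4 : (p.2 - e) k = 0 := by rw [Finsupp.tsub_apply, hek]; omega
        simp only [hz, if_false, h4, if_true, hle _ hz, add_tsub_cancel_right]

/-- The measure with mass `w α` at the generalized integer with exponent vector `α`. -/
def weighted (w : (ℕ →₀ ℕ) → ℝ≥0∞) : Measure ℝ :=
  Measure.sum fun α => w α • Measure.dirac (P.int α)

theorem weighted_mono {w v : (ℕ →₀ ℕ) → ℝ≥0∞} (h : ∀ α, w α ≤ v α) :
    P.weighted w ≤ P.weighted v := by
  refine Measure.le_iff.mpr fun s hs => ?_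
  rw [weighted, weighted, Measure.sum_apply _ hs, Measure.sum_apply _ hs]
  refine ENNReal.tsum_le_tsum fun α => ?_
  simp only [Measure.smul_apply, smul_eq_mul]
  gcongr
  exact h α

theorem weighted_one_Iic (x : ℝ) : P.weighted (fun _ => 1) (Set.Iic x) = (P.count x : ℝ≥0∞) := by
  rw [weighted, Measure.sum_apply _ measurableSet_Iic, count,
    tsum_eq_sum (s := (P.finite_int_le x).toFinset)]
  · rw [Finset.sum_congr rfl (g := fun _ => 1), Finset.sum_const, nsmul_eq_mul, mul_one]
    intro α hα
    have : P.int α ≤ x := by simpa using hα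
    simp [this]
  · intro α hα
    have : ¬ P.int α ≤ x := by simpa using hα
    simp [this]

theorem weighted_one_Iio : P.weighted (fun _ => 1) (Set.Iio 1) = 0 := by
  rw [weighted, Measure.sum_apply _ measurableSet_Iio, ENNReal.tsum_eq_zero]
  intro α
  simp [P.one_le_int α]

theorem integral_inv_weighted {w : (ℕ →₀ ℕ) → ℝ≥0∞} (hw : ∀ α, w α ≠ ⊤) (x : ℝ) :
    ∫ t in Set.Icc 1 x, t⁻¹ ∂P.weighted w =
      ∑ α ∈ (P.finite_int_le x).toFinset, (w α).toReal / P.int α := by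
  rw [← integral_indicator measurableSet_Icc, weighted, integral_sum_dirac hw,
    tsum_eq_sum (s := (P.finite_int_le x).toFinset)]
  · refine Finset.sum_congr rfl fun α hα => ?_
    have : P.int α ≤ x := by simpa using hα
    rw [Set.indicator_of_mem (Set.mem_Icc.mpr ⟨P.one_le_int α, this⟩), smul_eq_mul, div_eq_mul_inv]
  · intro α hα
    have : ¬ P.int α ≤ x := by simpa using hα
    rw [Set.indicator_of_notMem (fun h => this h.2), smul_zero]

/-- Cauchy product over exponent vectors. Working with exponents rather than values keeps
multiplicities correct when distinct products coincide. -/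
theorem zeta_mul_tsum_moebius {s : ℂ}
    (hs : Summable fun α => ‖((P.int α : ℝ) : ℂ) ^ (-s)‖) :
    P.zeta s * ∑' α, (moebius α : ℂ) * ((P.int α : ℝ) : ℂ) ^ (-s) = 1 := by
  have hm : Summable fun α => ‖(moebius α : ℂ) * ((P.int α : ℝ) : ℂ) ^ (-s)‖ := by
    refine hs.of_nonneg_of_le (fun α => norm_nonneg _) fun α => ?_
    rw [norm_mul]
    refine mul_le_of_le_one_left (norm_nonneg _) ?_
    rcases moebius_cases α with h | h | h <;> simp [h]
  have hsm : ∀ α β, ((P.int (α + β) : ℝ) : ℂ) ^ (-s) =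
      ((P.int α : ℝ) : ℂ) ^ (-s) * ((P.int β : ℝ) : ℂ) ^ (-s) := by
    intro α β
    rw [int_add, Complex.ofReal_mul, Complex.mul_cpow_ofReal_nonneg]
    · linarith [P.one_le_int α]
    · linarith [P.one_le_int β]
  have hprod := summable_mul_of_summable_norm hs hm
  have hcauchy := Summable.tsum_mul_tsum_eq_tsum_sum_antidiagonal hs.of_norm hm.of_norm hprod
  rw [zeta, hcauchy, tsum_eq_single 0]
  · simp [int_zero, moebius_zero]
  · intro α hα
    have h1 : ∀ p ∈ Finset.HasAntidiagonal.antidiagonal α, ((P.int p.1 : ℝ) : ℂ) ^ (-s) *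
        ((moebius p.2 : ℂ) * ((P.int p.2 : ℝ) : ℂ) ^ (-s)) =
        ((P.int α : ℝ) : ℂ) ^ (-s) * (moebius p.2 : ℂ) := by
      intro p hp
      rw [← Finset.HasAntidiagonal.mem_antidiagonal.mp hp, hsm]
      ring
    rw [Finset.sum_congr rfl h1, ← Finset.mul_sum, ← Complex.ofReal_sum,
      sum_antidiagonal_moebius, if_neg hα]
    simp

/-- The mean of the Moebius function of a discrete system tends to zero. -/
theorem tendsto_moebiusSum {a : ℝ} (ha : 0 < a)
    (hN : Tendsto (fun x : ℝ => (P.count x : ℝ) / x) atTop (𝓝 a))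
    (hZ : ZetaLowerBound P.zeta) : Tendsto P.moebiusSum atTop (𝓝 0) := by
  classical
  set ν := P.weighted fun _ => 1 with hν
  -- The positive and negative parts of μ; both weights are at most 1, so both measures are
  -- dominated by dN.
  let wp : (ℕ →₀ ℕ) → ℝ≥0∞ := fun α => if moebius α = 1 then 1 else 0
  let wq : (ℕ →₀ ℕ) → ℝ≥0∞ := fun α => if moebius α = -1 then 1 else 0
  have hwp : ∀ α, wp α ≤ 1 := fun α => by simp only [wp]; split_ifs <;> simp
  have hwq : ∀ α, wq α ≤ 1 := fun α => by simp only [wq]; split_ifs <;> simp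
  have hwp' : ∀ α, wp α ≠ ⊤ := fun α => ((hwp α).trans_lt ENNReal.one_lt_top).ne
  have hwq' : ∀ α, wq α ≠ ⊤ := fun α => ((hwq α).trans_lt ENNReal.one_lt_top).ne
  have hmu : ∀ α, (wp α).toReal - (wq α).toReal = moebius α := by
    intro α
    rcases moebius_cases α with h | h | h <;> simp only [wp, wq, h] <;> norm_num
  have hνx : ∀ x, ν (Set.Iic x) = (P.count x : ℝ≥0∞) := P.weighted_one_Iic
  have hνf : ∀ x, ν (Set.Iic x) ≠ ⊤ := fun x => by rw [hνx]; exact ENNReal.natCast_ne_top _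
  have hνa : Tendsto (fun x => (ν (Set.Iic x)).toReal / x) atTop (𝓝 a) := by
    simpa only [hνx, ENNReal.toReal_natCast] using hN
  obtain ⟨C, hC, hg⟩ := exists_hasLinearGrowth P.weighted_one_Iio hνf hνa
  have hmain := tendsto_mean_of_mellin P.weighted_one_Iio hνf ha hνa (P.weighted_mono hwp)
    (P.weighted_mono hwq) hZ fun s hs => by
      have hi := hg.integrable_cpow hs
      have hsum : Summable fun α => ‖((P.int α : ℝ) : ℂ) ^ (-s)‖ := by
        have := Integrable.summable_of_dirac hi
        simpa using this
      have hsp : Summable fun α => (wp α).toReal • ((P.int α : ℝ) : ℂ) ^ (-s) := by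
        have := ((hg.mono (P.weighted_mono hwp)).integrable_cpow hs).summable_of_dirac
        refine Summable.of_norm (this.congr fun α => ?_)
        rw [norm_smul, Real.norm_of_nonneg ENNReal.toReal_nonneg]
      have hsq : Summable fun α => (wq α).toReal • ((P.int α : ℝ) : ℂ) ^ (-s) := by
        have := ((hg.mono (P.weighted_mono hwq)).integrable_cpow hs).summable_of_dirac
        refine Summable.of_norm (this.congr fun α => ?_)
        rw [norm_smul, Real.norm_of_nonneg ENNReal.toReal_nonneg]
      rw [weighted, weighted, integral_sum_dirac hwp', integral_sum_dirac hwq',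
        ← hsp.tsum_sub hsq, ← P.zeta_mul_tsum_moebius hsum]
      congr 2
      ext α
      rw [← sub_smul, hmu, Complex.real_smul]
  refine hmain.congr fun x => ?_
  rw [P.integral_inv_weighted hwp', P.integral_inv_weighted hwq', ← Finset.sum_sub_distrib,
    moebiusSum]
  refine Finset.sum_congr rfl fun α _ => ?_
  rw [← sub_div, hmu]

end Primes

/-! ### Stieltjes functions carried by `[1, ∞)` -/

theorem stieltjes_tendsto_atBot {F : StieltjesFunction ℝ} (hF : ∀ x < 1, F x = 0) :
    Tendsto F atBot (𝓝 0) :=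
  tendsto_const_nhds.congr' ((eventually_lt_atBot 1).mono fun x hx => (hF x hx).symm)

theorem stieltjes_measure_Iic {F : StieltjesFunction ℝ} (hF : ∀ x < 1, F x = 0) (x : ℝ) :
    F.measure (Set.Iic x) = ENNReal.ofReal (F x) := by
  rw [F.measure_Iic (stieltjes_tendsto_atBot hF), sub_zero]

theorem stieltjes_measure_Iio_one {F : StieltjesFunction ℝ} (hF : ∀ x < 1, F x = 0) :
    F.measure (Set.Iio 1) = 0 := by
  have h : Set.Iio (1 : ℝ) = ⋃ n : ℕ, Set.Iic (1 - 1 / ((n : ℝ) + 1)) := by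
    ext x
    simp only [Set.mem_Iio, Set.mem_iUnion, Set.mem_Iic]
    constructor
    · intro hx
      obtain ⟨n, hn⟩ := exists_nat_one_div_lt (sub_pos.mpr hx)
      exact ⟨n, by linarith⟩
    · rintro ⟨n, hn⟩
      have : (0 : ℝ) < 1 / ((n : ℝ) + 1) := by positivity
      linarith
  rw [h, measure_iUnion_null_iff]
  intro n
  have : (0 : ℝ) < 1 / ((n : ℝ) + 1) := by positivity
  rw [stieltjes_measure_Iic hF, hF _ (by linarith), ENNReal.ofReal_zero]

/-- The distribution function of ρ serves; its right continuity is continuity of ρ from above. -/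
theorem exists_stieltjes_measure_eq {ρ : Measure ℝ} (h1 : ρ (Set.Iio 1) = 0)
    (h2 : ∀ x, ρ (Set.Iic x) ≠ ⊤) :
    ∃ F : StieltjesFunction ℝ, (∀ x < 1, F x = 0) ∧ F.measure = ρ := by
  have hm : Monotone fun x => (ρ (Set.Iic x)).toReal := fun x y hxy =>
    ENNReal.toReal_mono (h2 y) (measure_mono (Set.Iic_subset_Iic.mpr hxy))
  have hr : ∀ x, ContinuousWithinAt (fun x => (ρ (Set.Iic x)).toReal) (Set.Ici x) x := by
    intro x
    rw [← continuousWithinAt_Ioi_iff_Ici]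
    have h3 := tendsto_measure_biInter_gt (μ := ρ) (s := fun y : ℝ => Set.Iic y) (a := x)
      (fun r _ => measurableSet_Iic.nullMeasurableSet)
      (fun i j _ hij => Set.Iic_subset_Iic.mpr hij) ⟨x + 1, by simp, h2 _⟩
    have h4 : ⋂ r > x, Set.Iic r = Set.Iic x := by
      ext y
      simp only [Set.mem_iInter, Set.mem_Iic]
      exact ⟨fun h => le_of_forall_gt_imp_ge_of_dense h, fun h r hr => h.trans (le_of_lt hr)⟩
    rw [h4] at h3
    exact (ENNReal.tendsto_toReal (h2 x)).comp h3
  let F : StieltjesFunction ℝ := ⟨fun x => (ρ (Set.Iic x)).toReal, hm, hr⟩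
  refine ⟨F, fun x hx => ?_, ?_⟩
  · have : ρ (Set.Iic x) = 0 :=
      le_zero_iff.mp ((measure_mono fun y (hy : y ≤ x) => hy.trans_lt hx).trans_eq h1)
    change (ρ (Set.Iic x)).toReal = 0
    rw [this, ENNReal.toReal_zero]
  · refine Measure.ext_of_Ioc _ _ fun a b hab => ?_
    rw [F.measure_Ioc]
    change ENNReal.ofReal ((ρ (Set.Iic b)).toReal - (ρ (Set.Iic a)).toReal) = _
    rw [← Set.Iic_sdiff_Iic, measure_sdiff (Set.Iic_subset_Iic.mpr hab.le)
      measurableSet_Iic.nullMeasurableSet (h2 _),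
      ENNReal.ofReal_sub _ ENNReal.toReal_nonneg, ENNReal.ofReal_toReal (h2 _),
      ENNReal.ofReal_toReal (h2 _)]

/-! ### Mellin transforms of measures on `[1, ∞)` -/

/-- A measure carried by `[1, ∞)` for which `x ^ (-c)` is integrable. -/
structure MellinIntegrable (c : ℝ) (μ : Measure ℝ) : Prop where
  measure_Iio : μ (Set.Iio 1) = 0
  integrable : Integrable (fun x : ℝ => x ^ (-c)) μ

/-- The Mellin transform `∫ x ^ (-s) dμ(x)` of a measure. -/
def mellinMeasure (μ : Measure ℝ) (s : ℂ) : ℂ := ∫ x : ℝ, (x : ℂ) ^ (-s) ∂μ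

theorem ae_one_le_of_measure_Iio {μ : Measure ℝ} (h : μ (Set.Iio 1) = 0) : ∀ᵐ x ∂μ, 1 ≤ x := by
  rw [measure_eq_zero_iff_ae_notMem] at h
  filter_upwards [h] with x hx
  simpa using hx

theorem measure_Iio_of_ae_one_le {μ : Measure ℝ} (h : ∀ᵐ x ∂μ, 1 ≤ x) : μ (Set.Iio 1) = 0 := by
  rw [measure_eq_zero_iff_ae_notMem]
  filter_upwards [h] with x hx
  simpa using hx

namespace MellinIntegrable

variable {c : ℝ} {μ ν : Measure ℝ}

theorem ae_one_le (h : MellinIntegrable c μ) : ∀ᵐ x ∂μ, 1 ≤ x :=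
  ae_one_le_of_measure_Iio h.measure_Iio

theorem integrable_cpow (h : MellinIntegrable c μ) {s : ℂ} (hs : s.re = c) :
    Integrable (fun x : ℝ => (x : ℂ) ^ (-s)) μ := by
  refine h.integrable.mono' (measurable_ofReal_cpow _).aestronglyMeasurable ?_
  filter_upwards [h.ae_one_le] with x hx
  rw [norm_ofReal_cpow_neg hx, hs]

theorem of_integrable_cpow (h1 : μ (Set.Iio 1) = 0)
    (h2 : Integrable (fun x : ℝ => (x : ℂ) ^ (-(c : ℂ))) μ) : MellinIntegrable c μ := by
  refine ⟨h1, h2.norm.congr ?_⟩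
  filter_upwards [ae_one_le_of_measure_Iio h1] with x hx
  rw [norm_ofReal_cpow_neg hx, Complex.ofReal_re]

theorem dirac_one : MellinIntegrable c (Measure.dirac 1) :=
  ⟨by simp, integrable_dirac (by simp)⟩

theorem add (hμ : MellinIntegrable c μ) (hν : MellinIntegrable c ν) :
    MellinIntegrable c (μ + ν) :=
  ⟨by simp [hμ.measure_Iio, hν.measure_Iio], hμ.integrable.add_measure hν.integrable⟩

theorem ae_prod_one_le [SFinite ν] (hμ : μ (Set.Iio 1) = 0) (hν : ν (Set.Iio 1) = 0) :
    ∀ᵐ p ∂μ.prod ν, 1 ≤ p.1 ∧ 1 ≤ p.2 :=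
  (Measure.quasiMeasurePreserving_fst.ae (ae_one_le_of_measure_Iio hμ)).and
    (Measure.quasiMeasurePreserving_snd.ae (ae_one_le_of_measure_Iio hν))

theorem mconv [SFinite μ] [SFinite ν] (hμ : MellinIntegrable c μ) (hν : MellinIntegrable c ν) :
    MellinIntegrable c (Measure.mconv μ ν) := by
  have hm : Measurable fun p : ℝ × ℝ => p.1 * p.2 := by fun_prop
  have hae := ae_prod_one_le hμ.measure_Iio hν.measure_Iio
  constructor
  · refine measure_Iio_of_ae_one_le ?_
    rw [Measure.mconv, ae_map_iff hm.aemeasurable measurableSet_Ici]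
    filter_upwards [hae] with p hp
    exact one_le_mul_of_one_le_of_one_le hp.1 hp.2
  · have hf : Measurable fun x : ℝ => x ^ (-c) := by fun_prop
    rw [Measure.mconv, integrable_map_measure hf.aestronglyMeasurable hm.aemeasurable]
    refine (hμ.integrable.mul_prod hν.integrable).congr ?_
    filter_upwards [hae] with p hp
    rw [Function.comp, Real.mul_rpow (by linarith [hp.1]) (by linarith [hp.2])]

/-- Weighting by x^(-c) and pushing forward by log yields a finite measure whose characteristic
function at t is the Mellin transform at c - it. Characteristic functions determine finite measures,
and both operations can be undone on [1, ∞). -/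
theorem ext (hμ : MellinIntegrable c μ) (hν : MellinIntegrable c ν)
    (h : ∀ s : ℂ, s.re = c → mellinMeasure μ s = mellinMeasure ν s) : μ = ν := by
  let w : ℝ → ℝ≥0∞ := fun x => ENNReal.ofReal (x ^ (-c))
  have hwm : Measurable w := by fun_prop
  have hrec : ∀ {ρ : Measure ℝ}, MellinIntegrable c ρ → ρ =
      (((ρ.withDensity w).map Real.log).map Real.exp).withDensity fun x => (w x)⁻¹ := by
    intro ρ hρ
    have h0 : ∀ᵐ x ∂ρ, w x ≠ 0 := by
      filter_upwards [hρ.ae_one_le] with x hx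
      simpa [w] using Real.rpow_pos_of_pos (by linarith : 0 < x) (-c)
    rw [Measure.map_map Real.measurable_exp Real.measurable_log]
    have h1 : (ρ.withDensity w).map (Real.exp ∘ Real.log) = (ρ.withDensity w).map id := by
      refine Measure.map_congr ?_
      refine (withDensity_absolutelyContinuous ρ w).ae_le ?_
      filter_upwards [hρ.ae_one_le] with x hx
      simp [Real.exp_log (by linarith : 0 < x)]
    rw [h1, Measure.map_id]
    exact (withDensity_inv_same hwm h0 (Eventually.of_forall fun x => ENNReal.ofReal_ne_top)).symm
  have hfin : ∀ {ρ : Measure ℝ}, MellinIntegrable c ρ → IsFiniteMeasure (ρ.withDensity w) :=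
    fun hρ => isFiniteMeasure_withDensity_ofReal hρ.integrable.2
  have hchar : ∀ {ρ : Measure ℝ}, MellinIntegrable c ρ → ∀ t : ℝ,
      charFun ((ρ.withDensity w).map Real.log) t = mellinMeasure ρ (c - t * Complex.I) := by
    intro ρ hρ t
    rw [charFun_apply_real, integral_map Real.measurable_log.aemeasurable
      (by apply Measurable.aestronglyMeasurable; fun_prop),
      integral_withDensity_eq_integral_toReal_smul hwm
        (Eventually.of_forall fun x => ENNReal.ofReal_lt_top), mellinMeasure]
    apply integral_congr_ae
    filter_upwards [hρ.ae_one_le] with x hx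
    have hx0 : 0 < x := by linarith
    have hxc : (x : ℂ) ≠ 0 := by exact_mod_cast hx0.ne'
    simp only [w]
    rw [ENNReal.toReal_ofReal (Real.rpow_nonneg hx0.le _), Complex.real_smul,
      Complex.ofReal_cpow hx0.le, Complex.cpow_def_of_ne_zero hxc, Complex.cpow_def_of_ne_zero hxc,
      ← Complex.exp_add, ← Complex.ofReal_log hx0.le]
    congr 1
    push_cast
    ring
  have := hfin hμ
  have := hfin hν
  have hmap : (μ.withDensity w).map Real.log = (ν.withDensity w).map Real.log := by
    refine Measure.ext_of_charFun ?_
    ext t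
    rw [hchar hμ, hchar hν]
    exact h _ (by simp)
  rw [hrec hμ, hmap, ← hrec hν]

end MellinIntegrable

theorem mellinMeasure_dirac_one (s : ℂ) : mellinMeasure (Measure.dirac 1) s = 1 := by
  simp [mellinMeasure]

theorem mellinMeasure_add {c : ℝ} {μ ν : Measure ℝ} (hμ : MellinIntegrable c μ)
    (hν : MellinIntegrable c ν) {s : ℂ} (hs : s.re = c) :
    mellinMeasure (μ + ν) s = mellinMeasure μ s + mellinMeasure ν s :=
  integral_add_measure (hμ.integrable_cpow hs) (hν.integrable_cpow hs)

theorem mellinMeasure_mconv {μ ν : Measure ℝ} [SFinite μ] [SFinite ν] (hμ : μ (Set.Iio 1) = 0)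
    (hν : ν (Set.Iio 1) = 0) (s : ℂ) :
    mellinMeasure (Measure.mconv μ ν) s = mellinMeasure μ s * mellinMeasure ν s := by
  rw [mellinMeasure, Measure.mconv, integral_map (by fun_prop)
    (measurable_ofReal_cpow _).aestronglyMeasurable, mellinMeasure, mellinMeasure,
    ← integral_prod_mul]
  apply integral_congr_ae
  filter_upwards [MellinIntegrable.ae_prod_one_le hμ hν] with p hp
  rw [Complex.ofReal_mul, Complex.mul_cpow_ofReal_nonneg (by linarith [hp.1]) (by linarith [hp.2])]

/-- The iterated multiplicative convolution powers of a measure. -/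
def mconvPow (μ : Measure ℝ) : ℕ → Measure ℝ
  | 0 => Measure.dirac 1
  | n + 1 => Measure.mconv (mconvPow μ n) μ

instance sFinite_mconvPow (μ : Measure ℝ) [SFinite μ] : ∀ n, SFinite (mconvPow μ n)
  | 0 => by unfold mconvPow; infer_instance
  | n + 1 => by
    have := sFinite_mconvPow μ n
    unfold mconvPow
    infer_instance

theorem MellinIntegrable.mconvPow {c : ℝ} {μ : Measure ℝ} [SFinite μ] (h : MellinIntegrable c μ)
    (n : ℕ) : MellinIntegrable c (mconvPow μ n) := by
  induction n with
  | zero => exact MellinIntegrable.dirac_one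
  | succ n ih => exact ih.mconv h

theorem mellinMeasure_mconvPow {c : ℝ} {μ : Measure ℝ} [SFinite μ] (h : MellinIntegrable c μ)
    (s : ℂ) (n : ℕ) : mellinMeasure (mconvPow μ n) s = mellinMeasure μ s ^ n := by
  induction n with
  | zero => rw [pow_zero]; exact mellinMeasure_dirac_one s
  | succ n ih =>
    rw [pow_succ, ← ih]
    exact mellinMeasure_mconv (h.mconvPow n).measure_Iio h.measure_Iio s

theorem mellinMeasure_ofReal {c : ℝ} {μ : Measure ℝ} (h : MellinIntegrable c μ) :
    mellinMeasure μ (c : ℂ) = ((∫ x : ℝ, x ^ (-c) ∂μ : ℝ) : ℂ) := by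
  rw [mellinMeasure, ← integral_complex_ofReal]
  apply integral_congr_ae
  filter_upwards [h.ae_one_le] with x hx
  rw [Complex.ofReal_cpow (by linarith), Complex.ofReal_neg]

/-- The sum of the `1 / (e k)!` multiples of the convolution powers `μ ^ (e k)`. -/
def expPart (μ : Measure ℝ) (e : ℕ → ℕ) : Measure ℝ :=
  Measure.sum fun k => ((((e k).factorial : NNReal)⁻¹ : NNReal)) • mconvPow μ (e k)

/-- The n-th convolution power integrates x^(-c) to L^n, so the total is a subseries of the
exponential series; injectivity of e prevents repeated terms. -/
theorem MellinIntegrable.expPart {c : ℝ} {μ : Measure ℝ} [SFinite μ] (h : MellinIntegrable c μ)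
    {e : ℕ → ℕ} (he : Function.Injective e) : MellinIntegrable c (expPart μ e) := by
  constructor
  · rw [Beurling.expPart, Measure.sum_apply _ measurableSet_Iio, ENNReal.tsum_eq_zero]
    intro k
    simp [(h.mconvPow (e k)).measure_Iio]
  · set L := ∫ x : ℝ, x ^ (-c) ∂μ with hL
    have hpow : ∀ n, ∫ x : ℝ, x ^ (-c) ∂Beurling.mconvPow μ n = L ^ n := by
      intro n
      have h1 := mellinMeasure_mconvPow h (c : ℂ) n
      rw [mellinMeasure_ofReal h, mellinMeasure_ofReal (h.mconvPow n)] at h1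
      exact_mod_cast h1
    refine integrable_sum_measure (fun k => (h.mconvPow (e k)).integrable.smul_measure_nnreal) ?_
    refine ((Real.summable_pow_div_factorial L).comp_injective he).congr fun k => ?_
    rw [integral_smul_nnreal_measure, integral_congr_ae (g := fun x : ℝ => x ^ (-c)), hpow]
    · simp [NNReal.smul_def, div_eq_inv_mul]
    · filter_upwards [(h.mconvPow (e k)).ae_one_le] with x hx
      exact Real.norm_of_nonneg (Real.rpow_nonneg (by linarith) _)

theorem hasSum_mellinMeasure_expPart {c : ℝ} {μ : Measure ℝ} [SFinite μ]
    (h : MellinIntegrable c μ) {e : ℕ → ℕ} (he : Function.Injective e) {s : ℂ} (hs : s.re = c) :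
    HasSum (fun k => mellinMeasure μ s ^ e k / ((e k).factorial : ℂ))
      (mellinMeasure (expPart μ e) s) := by
  have h1 := hasSum_integral_measure ((h.expPart he).integrable_cpow hs)
  refine h1.congr_fun ?_
  intro k
  rw [integral_smul_nnreal_measure, ← mellinMeasure_mconvPow h, mellinMeasure]
  simp [NNReal.smul_def, div_eq_inv_mul]

instance sFinite_expPart (μ : Measure ℝ) [SFinite μ] (e : ℕ → ℕ) : SFinite (expPart μ e) := by
  unfold expPart
  infer_instance

/-- If `dN = exp(dΠ)`, then `dP = cosh(dΠ)` and `dQ = sinh(dΠ)` split `dN`, and `dP - dQ` is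
its convolution inverse. -/
theorem exists_split {c : ℝ} {ν μ : Measure ℝ} [SFinite ν] [SFinite μ]
    (hν : MellinIntegrable c ν) (hμ : MellinIntegrable c μ)
    (h : ∀ s : ℂ, s.re = c → mellinMeasure ν s = Complex.exp (mellinMeasure μ s)) :
    ∃ P Q : Measure ℝ, P + Q = ν ∧
      Measure.mconv ν P = Measure.dirac 1 + Measure.mconv ν Q := by
  have he : Function.Injective fun k : ℕ => 2 * k := fun a b hab => by simpa using hab
  have ho : Function.Injective fun k : ℕ => 2 * k + 1 := fun a b hab => by simpa using hab
  have hP := hμ.expPart he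
  have hQ := hμ.expPart ho
  have hPs : ∀ s : ℂ, s.re = c → mellinMeasure (expPart μ fun k => 2 * k) s =
      Complex.cosh (mellinMeasure μ s) := fun s hs =>
    (hasSum_mellinMeasure_expPart hμ he hs).unique (Complex.hasSum_cosh _)
  have hQs : ∀ s : ℂ, s.re = c → mellinMeasure (expPart μ fun k => 2 * k + 1) s =
      Complex.sinh (mellinMeasure μ s) := fun s hs =>
    (hasSum_mellinMeasure_expPart hμ ho hs).unique (Complex.hasSum_sinh _)
  -- On the line Re s = c the two identities read cosh z + sinh z = e^z and e^z cosh z = 1 + e^z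
  -- sinh z.
  refine ⟨_, _, (hP.add hQ).ext hν fun s hs => ?_,
    (hν.mconv hP).ext (MellinIntegrable.dirac_one.add (hν.mconv hQ)) fun s hs => ?_⟩
  · rw [mellinMeasure_add hP hQ hs, hPs s hs, hQs s hs, h s hs, Complex.cosh_add_sinh]
  · rw [mellinMeasure_add MellinIntegrable.dirac_one (hν.mconv hQ) hs,
      mellinMeasure_mconv hν.measure_Iio hP.measure_Iio,
      mellinMeasure_mconv hν.measure_Iio hQ.measure_Iio, hPs s hs, hQs s hs, h s hs,
      mellinMeasure_dirac_one, ← Complex.cosh_add_sinh]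
    linear_combination Complex.cosh_sq_sub_sinh_sq (mellinMeasure μ s)

/-! ### Uniqueness of the convolution inverse -/

theorem mconv_Iic_ne_top {μ ν : Measure ℝ} [SFinite μ] [SFinite ν] (hμ : μ (Set.Iio 1) = 0)
    (hν : ν (Set.Iio 1) = 0) (hμf : ∀ x, μ (Set.Iic x) ≠ ⊤) (hνf : ∀ x, ν (Set.Iic x) ≠ ⊤)
    (x : ℝ) : Measure.mconv μ ν (Set.Iic x) ≠ ⊤ := by
  rw [Measure.mconv, Measure.map_apply (by fun_prop) measurableSet_Iic]
  have h1 : (μ.prod ν) ((fun p : ℝ × ℝ => p.1 * p.2) ⁻¹' Set.Iic x) ≤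
      (μ.prod ν) (Set.Iic x ×ˢ Set.Iic x) := by
    refine measure_mono_ae ?_
    filter_upwards [MellinIntegrable.ae_prod_one_le hμ hν] with p hp hpx
    have hpx : p.1 * p.2 ≤ x := hpx
    exact ⟨show p.1 ≤ x by nlinarith [hp.1, hp.2], show p.2 ≤ x by nlinarith [hp.1, hp.2]⟩
  refine (h1.trans_lt ?_).ne
  rw [Measure.prod_prod]
  exact ENNReal.mul_lt_top (hμf x).lt_top (hνf x).lt_top

theorem mconv_right_comm (κ μ ν : Measure ℝ) [SFinite κ] [SFinite μ] [SFinite ν] :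
    Measure.mconv (Measure.mconv κ μ) ν = Measure.mconv (Measure.mconv κ ν) μ := by
  rw [Measure.mconv_assoc, Measure.mconv_comm μ ν, ← Measure.mconv_assoc]

/-- Two convolution inverses `P - Q` and `P' - Q'` agree up to a common summand. -/
theorem add_mconv_eq_of_inverse {ν P Q P' Q' : Measure ℝ} [SFinite ν] [SFinite P] [SFinite Q]
    [SFinite P'] [SFinite Q']
    (h : Measure.mconv ν P = Measure.dirac 1 + Measure.mconv ν Q)
    (h' : Measure.mconv ν P' = Measure.dirac 1 + Measure.mconv ν Q') :
    P + Q' + Measure.mconv (Measure.mconv ν Q) Q' =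
      P' + Q + Measure.mconv (Measure.mconv ν Q) Q' := by
  have e : ∀ ρ : Measure ℝ, SFinite ρ → Measure.mconv (Measure.mconv ν P) ρ =
      ρ + Measure.mconv (Measure.mconv ν Q) ρ := by
    intro ρ _
    rw [h, Measure.add_mconv, Measure.dirac_one_mconv]
  have e' : ∀ ρ : Measure ℝ, SFinite ρ → Measure.mconv (Measure.mconv ν P') ρ =
      ρ + Measure.mconv (Measure.mconv ν Q') ρ := by
    intro ρ _
    rw [h', Measure.add_mconv, Measure.dirac_one_mconv]
  -- Expand ν * P * P' in two ways, using first one inverse relation and then the other; the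
  -- leftover products ν * Q' * P and ν * Q * P' are expanded once more.
  have h1 := e P' inferInstance
  rw [mconv_right_comm, e' P inferInstance, mconv_right_comm ν Q' P, e Q' inferInstance,
    mconv_right_comm ν Q P', e' Q inferInstance, mconv_right_comm ν Q' Q] at h1
  rw [add_assoc, add_assoc, h1]

/-- The common summand may have infinite total mass, so it can be cancelled only on bounded sets,
which is all that m(x) sees. -/
theorem restrict_eq_of_inverse {ν P Q P' Q' : Measure ℝ} [SFinite ν] [SFinite P] [SFinite Q]
    [SFinite P'] [SFinite Q']
    (h : Measure.mconv ν P = Measure.dirac 1 + Measure.mconv ν Q)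
    (h' : Measure.mconv ν P' = Measure.dirac 1 + Measure.mconv ν Q') {x : ℝ}
    (hx : Measure.mconv (Measure.mconv ν Q) Q' (Set.Iic x) ≠ ⊤) :
    (P + Q').restrict (Set.Icc 1 x) = (P' + Q).restrict (Set.Icc 1 x) := by
  ext s hs
  rw [Measure.restrict_apply hs, Measure.restrict_apply hs]
  have h1 := congrArg (fun m : Measure ℝ => m (s ∩ Set.Icc 1 x)) (add_mconv_eq_of_inverse h h')
  simp only [Measure.add_apply _ (Measure.mconv _ _)] at h1
  refine (ENNReal.add_left_inj ?_).mp h1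
  exact ((measure_mono (Set.inter_subset_right.trans Set.Icc_subset_Iic_self)).trans_lt
    hx.lt_top).ne

theorem integrableOn_inv_of_measure_Iic {μ : Measure ℝ} {x : ℝ} (h : μ (Set.Iic x) ≠ ⊤) :
    IntegrableOn (fun t => t⁻¹) (Set.Icc 1 x) μ := by
  refine Measure.integrableOn_of_bounded (M := 1)
    ((measure_mono Set.Icc_subset_Iic_self).trans_lt h.lt_top).ne
    measurable_inv.aestronglyMeasurable ?_
  filter_upwards [ae_restrict_mem measurableSet_Icc] with t ht
  rw [norm_inv, Real.norm_of_nonneg (by linarith [ht.1])]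
  exact inv_le_one_of_one_le₀ ht.1

/-- The parts of an arbitrary inverse need not be dominated by dN, as the Tauberian argument
requires. This reduces every representation to the cosh/sinh one. -/
theorem moebiusMean_eq_of_isConvInverse {N P Q P' Q' : StieltjesFunction ℝ}
    (hN : ∀ x < 1, N x = 0) (h : IsConvInverse N P Q) (h' : IsConvInverse N P' Q') :
    moebiusMean P Q = moebiusMean P' Q' := by
  obtain ⟨hP, hQ, h⟩ := h
  obtain ⟨hP', hQ', h'⟩ := h'
  have hf : ∀ {F : StieltjesFunction ℝ}, (∀ x < 1, F x = 0) → ∀ x, F.measure (Set.Iic x) ≠ ⊤ :=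
    fun hF x => by rw [stieltjes_measure_Iic hF]; exact ENNReal.ofReal_ne_top
  have h0 : ∀ {F : StieltjesFunction ℝ}, (∀ x < 1, F x = 0) → F.measure (Set.Iio 1) = 0 :=
    fun hF => stieltjes_measure_Iio_one hF
  have hNQ0 : Measure.mconv N.measure Q.measure (Set.Iio 1) = 0 := by
    rw [Measure.mconv, Measure.map_apply (by fun_prop) measurableSet_Iio,
      measure_eq_zero_iff_ae_notMem]
    filter_upwards [MellinIntegrable.ae_prod_one_le (h0 hN) (h0 hQ)] with p hp
    have := one_le_mul_of_one_le_of_one_le hp.1 hp.2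
    simpa using this
  ext x
  have h1 := restrict_eq_of_inverse h h' (x := x)
    (mconv_Iic_ne_top hNQ0 (h0 hQ') (mconv_Iic_ne_top (h0 hN) (h0 hQ) (hf hN) (hf hQ)) (hf hQ') x)
  have h2 := congrArg (fun m : Measure ℝ => ∫ t, t⁻¹ ∂m) h1
  simp only [Measure.restrict_add] at h2
  rw [integral_add_measure (integrableOn_inv_of_measure_Iic (hf hP x))
    (integrableOn_inv_of_measure_Iic (hf hQ' x)),
    integral_add_measure (integrableOn_inv_of_measure_Iic (hf hP' x))
    (integrableOn_inv_of_measure_Iic (hf hQ x))] at h2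
  unfold moebiusMean
  linarith

/-! ### Conclusion for generalized number systems -/

/-- The convolution inverse of a generalized number system, split into parts bounded by `dN`. -/
theorem System.exists_isConvInverse (B : System) : ∃ P Q : StieltjesFunction ℝ,
    IsConvInverse B.N P Q ∧ P.measure ≤ B.N.measure ∧ Q.measure ≤ B.N.measure := by
  obtain ⟨σ₀, hlink⟩ := B.link
  have hre : ∀ s : ℂ, s.re = σ₀ + 1 → σ₀ < s.re := fun s hs => by rw [hs]; linarith
  have hc := hlink ((σ₀ + 1 : ℝ) : ℂ) (hre _ (Complex.ofReal_re _))
  have hN0 := stieltjes_measure_Iio_one B.N_eq_zero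
  have hPi0 := stieltjes_measure_Iio_one fun x hx => B.Pi_eq_zero x (le_of_lt hx)
  obtain ⟨P, Q, hPQ, hinv⟩ := exists_split (MellinIntegrable.of_integrable_cpow hN0 hc.1)
    (MellinIntegrable.of_integrable_cpow hPi0 hc.2.1) fun s hs => (hlink s (hre s hs)).2.2
  have hP : P ≤ B.N.measure := hPQ ▸ Measure.le_add_right le_rfl
  have hQ : Q ≤ B.N.measure := hPQ ▸ Measure.le_add_left le_rfl
  have hex : ∀ ρ : Measure ℝ, ρ ≤ B.N.measure →
      ∃ F : StieltjesFunction ℝ, (∀ x < 1, F x = 0) ∧ F.measure = ρ := fun ρ hρ =>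
    exists_stieltjes_measure_eq (le_zero_iff.mp ((hρ _).trans_eq hN0)) fun x =>
      ((hρ _).trans_lt (by
        rw [stieltjes_measure_Iic B.N_eq_zero]; exact ENNReal.ofReal_lt_top)).ne
  obtain ⟨F, hF, rfl⟩ := hex P hP
  obtain ⟨G, hG, rfl⟩ := hex Q hQ
  exact ⟨F, G, ⟨hF, hG, hinv⟩, hP, hQ⟩

theorem System.tendsto_moebiusMean (B : System) {a : ℝ} (ha : 0 < a)
    (hN : Tendsto (fun x : ℝ => B.N x / x) atTop (𝓝 a)) (hZ : ZetaLowerBound B.zeta)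
    {P Q : StieltjesFunction ℝ} (h : IsConvInverse B.N P Q) :
    Tendsto (moebiusMean P Q) atTop (𝓝 0) := by
  obtain ⟨F, G, hFG, hF, hG⟩ := B.exists_isConvInverse
  rw [moebiusMean_eq_of_isConvInverse B.N_eq_zero h hFG]
  have hN0 := stieltjes_measure_Iio_one B.N_eq_zero
  have hnn : ∀ x, 0 ≤ B.N x := fun x => by
    rw [← B.N_eq_zero (min x 0) (by simp)]
    exact B.N.mono (min_le_left _ _)
  have hNf : ∀ x, B.N.measure (Set.Iic x) ≠ ⊤ := fun x => by
    rw [stieltjes_measure_Iic B.N_eq_zero]; exact ENNReal.ofReal_ne_top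
  have hNa : Tendsto (fun x => (B.N.measure (Set.Iic x)).toReal / x) atTop (𝓝 a) := by
    simpa only [stieltjes_measure_Iic B.N_eq_zero, ENNReal.toReal_ofReal (hnn _)] using hN
  obtain ⟨C, hC, hg⟩ := exists_hasLinearGrowth hN0 hNf hNa
  refine tendsto_mean_of_mellin hN0 hNf ha hNa hF hG hZ fun s hs => ?_
  have hmi : ∀ {μ : Measure ℝ}, HasLinearGrowth μ C → MellinIntegrable s.re μ := fun hμ =>
    ⟨hμ.measure_Iio, hμ.integrable_rpow hs⟩
  have hNi := hmi hg
  have hFi := hmi (hg.mono hF)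
  have hGi := hmi (hg.mono hG)
  -- Transforming the identity of measures, rather than the exponential formula known only for Re s
  -- > σ₀, gives the reciprocal of zeta on all of Re s > 1 without analytic continuation.
  have h1 := congrArg (fun m => mellinMeasure m s) hFG.2.2
  rw [mellinMeasure_mconv hNi.measure_Iio hFi.measure_Iio,
    mellinMeasure_add MellinIntegrable.dirac_one (hNi.mconv hGi) rfl, mellinMeasure_dirac_one,
    mellinMeasure_mconv hNi.measure_Iio hGi.measure_Iio] at h1
  change mellinMeasure B.N.measure s * (mellinMeasure F.measure s - mellinMeasure G.measure s) = 1
  linear_combination h1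

end Beurling

end

theorem theorem3 :
    -- discrete systems
    (∀ (P : Beurling.Primes) (a : ℝ), 0 < a →
      Tendsto (fun x : ℝ => (P.count x : ℝ) / x) atTop (𝓝 a) →
      Beurling.ZetaLowerBound P.zeta →
      Tendsto P.moebiusSum atTop (𝓝 0)) ∧
    -- general systems
    (∀ (B : Beurling.System) (a : ℝ), 0 < a →
      Tendsto (fun x : ℝ => B.N x / x) atTop (𝓝 a) →
      Beurling.ZetaLowerBound B.zeta →
      (∃ P Q : StieltjesFunction ℝ, Beurling.IsConvInverse B.N P Q) ∧
      ∀ P Q : StieltjesFunction ℝ, Beurling.IsConvInverse B.N P Q →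
        Tendsto (Beurling.moebiusMean P Q) atTop (𝓝 0)) := by
  refine ⟨fun P a ha hN hZ => P.tendsto_moebiusSum ha hN hZ, fun B a ha hN hZ => ⟨?_, ?_⟩⟩
  · obtain ⟨P, Q, h, -⟩ := B.exists_isConvInverse
    exact ⟨P, Q, h⟩
  · exact fun P Q h => B.tendsto_moebiusMean ha hN hZ h
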